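/- An overpartition $\lambda$ is a finite (possibly empty) sequence of parts $\lambda_1\le\lambda_2\le\cdots\le\lambda_\ell$, each part being a positive integer $t$ or an overlined positive integer $\overline t$, listed in the order $\overline1<1<\overline2<2<\cdots$, in which each $\overline t$ occurs at most once. Write $f_t(\lambda)$ and $f_{\overline t}(\lambda)$ for the numbers of occurrences of $t$ and $\overline t$, $|\lambda_j|$ for the size of a part, and $|\lambda|$ for the sum of the sizes. The Göllnitz–Gordon marking assigns positive integers (marks) to $\lambda_1,\ldots,\lambda_\ell$ successively, as follows. A non-overlined odd part or an overlined even part gets the mark $1$. An overlined odd part $\lambda_p$ gets the least positive integer that is not the mark of a part $\lambda_j$ with $j<p$ and $|\lambda_p|-|\lambda_j|=1$. For a non-overlined even part $\lambda_p=2t+2$, let $f$ be the least positive integer that is not the mark of a part $\lambda_j$ with $j<p$ and $|\lambda_p|-|\lambda_j|\le 2$, and let $g$ be the least mark of the parts $\lambda_j$ with $j<p$ and $|\lambda_p|-|\lambda_j|=2$ ($g=0$ if there are none); $\lambda_p$ gets the mark $g$ if $g\ge2$, the mark of $\lambda_{p-1}$ is $g-1$, $2t+1$ or $\overline{2t+2}$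 occurs in $\lambda$, and $\overline{2t+1}$ does not occur in $\lambda$; otherwise it gets the mark $f$. Let $k\ge i\ge1$ and $N_1\ge N_2\ge\cdots\ge N_{k-1}\ge0$ be integers (if $k=1$ the sequence is empty and $N_1:=0$). Let $\mathbb G_{N_1,\ldots,N_{k-1};i}$ be the set of overpartitions $\lambda$ without overlined even parts and without non-overlined odd parts such that 1. $f_{\overline1}(\lambda)+f_2(\lambda)\le i-1$; 2. $f_{\overline{2t}}(\lambda)+f_{2t}(\lambda)+f_{\overline{2t+1}}(\lambda)+f_{2t+2}(\lambda)\le k-1$ for all $t$; 3. if $f_{2t+1}(\lambda)\ge1$, then $f_{2t+2}(\lambda)\le k-2$; 4. for $1\le r\le k-1$, exactly $N_r$ parts of $\lambda$ have the mark $r$ in the Göllnitz–Gordon marking of $\lambda$. Let $\mathbb E_{N_1,\ldots,N_{k-1};i}$ be the set of those members of $\mathbb G_{N_1,\ldots,N_{k-1};i}$ that have no overlined odd parts. Let $\mathbb D_N$ be the set of partitions $\eta$ into distinct negative odd parts lying in $[1-2N,-1]$ (including the empty one), $|\eta|$ being the sum of the parts. Then there is a bijection $\Theta$ from $\mathbb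 G_{N_1,\ldots,N_{k-1};i}$ to $\mathbb D_{N_1}\times\mathbb E_{N_1,\ldots,N_{k-1};i}$ such that $|\mu|=|\eta|+|\nu|$ whenever $\Theta(\mu)=(\eta,\nu)$. Moreover, $\mathbb G_{N_1,\ldots,N_{k-1};i}$ and $\mathbb E_{N_1,\ldots,N_{k-1};i}$ have only finitely many members of each size, and, as formal Laurent series in $q$, $$\sum_{\mu\in\mathbb G_{N_1,\ldots,N_{k-1};i}}q^{|\mu|}=(-q^{1-2N_1};q^2)_{N_1}\sum_{\nu\in\mathbb E_{N_1,\ldots,N_{k-1};i}}q^{|\nu|},$$ where $(a;q)_n=\prod_{j=0}^{n-1}(1-aq^j)$. -/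

import Mathlib

namespace GollnitzGordon

/-- A part of an overpartition: its size, and whether it is overlined. -/
structure Part where
  size : ℕ
  overlined : Bool
deriving DecidableEq

/-- The position of a part in the order `1̄ < 1 < 2̄ < 2 < ⋯` (an injective function of parts). -/
def Part.rank (a : Part) : ℕ := 2 * a.size + (if a.overlined then 0 else 1)

/-- An overpartition, as the list of its parts `λ₁ ≤ λ₂ ≤ ⋯ ≤ λ_ℓ` in the order
`1̄ < 1 < 2̄ < 2 < ⋯`: each number may be overlined at most once. -/
structure Overpartition where
  parts : List Part
  sorted : parts.Pairwise (fun a b => a.rank ≤ b.rank)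
  pos : ∀ a ∈ parts, 0 < a.size
  overlined_le_one : ∀ t : ℕ, parts.count ⟨t, true⟩ ≤ 1

namespace Overpartition

/-- `|l|`, the sum of the sizes of the parts. -/
def size (l : Overpartition) : ℕ := (l.parts.map Part.size).sum

/-- `f_t`, the number of occurrences of the non-overlined part `t`. -/
def f (l : Overpartition) (t : ℕ) : ℕ := l.parts.count ⟨t, false⟩

/-- `f_{t̄}`, the number of occurrences of the overlined part `t̄`. -/
def fbar (l : Overpartition) (t : ℕ) : ℕ := l.parts.count ⟨t, true⟩

end Overpartition

theorem exists_unused (S : List ℕ) : ∃ s : ℕ, 0 < s ∧ s ∉ S := by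
  obtain ⟨s, hs⟩ := Infinite.exists_notMem_finset (insert 0 S.toFinset)
  simp only [Finset.mem_insert, List.mem_toFinset, not_or] at hs
  exact ⟨s, Nat.pos_of_ne_zero hs.1, hs.2⟩

/-- The least positive integer that does not occur in the list `S`. -/
def leastUnused (S : List ℕ) : ℕ := Nat.find (exists_unused S)

/-- The marks, among the marked parts in `done`, of those whose size satisfies `P`. -/
def marksWhere (done : List (Part × ℕ)) (P : ℕ → Prop) [DecidablePred P] : List ℕ :=
  (done.filter (fun y => P y.1.size)).map Prod.snd

/-- The mark of the part `x` of an overpartition with list of parts `all`, given the list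
`done` of the smaller parts with their marks, the most recently marked part first.
For the smallest part (`done = []`) all cases give the mark `1`. -/
def nextMark (all : List Part) (done : List (Part × ℕ)) (x : Part) : ℕ :=
  if Odd x.size then
    if x.overlined then
      leastUnused (marksWhere done (fun b => x.size = b + 1))
    else 1
  else
    if x.overlined then 1
    else
      let f := leastUnused (marksWhere done (fun b => x.size ≤ b + 2))
      -- the least mark of a part of size `x.size - 2`, and `0` if there is no such part
      let g := ((marksWhere done (fun b => x.size = b + 2)).min?).getD 0
      if 2 ≤ g ∧ done.head?.map Prod.snd = some (g - 1) ∧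
          ((⟨x.size - 1, false⟩ : Part) ∈ all ∨ (⟨x.size, true⟩ : Part) ∈ all) ∧
          (⟨x.size - 1, true⟩ : Part) ∉ all
      then g else f

/-- Marks the remaining parts one after the other, from smallest to largest. -/
def markAux (all : List Part) : List (Part × ℕ) → List Part → List (Part × ℕ)
  | done, [] => done.reverse
  | done, x :: xs => markAux all ((x, nextMark all done x) :: done) xs

namespace Overpartition

/-- The Göllnitz–Gordon marking: the list of the parts, from smallest to largest, each with
its mark. -/
def marking (l : Overpartition) : List (Part × ℕ) := markAux l.parts [] l.parts

/-- The number of `r`-marked parts. -/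
def numMarked (l : Overpartition) (r : ℕ) : ℕ := (l.marking.map Prod.snd).count r

/-- The overpartitions counted by `O_{k,i}`. -/
def IsO (k i : ℕ) (l : Overpartition) : Prop :=
  l.fbar 1 + l.f 2 ≤ i - 1 ∧
  (∀ t : ℕ, l.fbar (2 * t) + l.f (2 * t) + l.fbar (2 * t + 1) + l.f (2 * t + 2) ≤ k - 1) ∧
  (∀ t : ℕ, 1 ≤ l.f (2 * t + 1) → l.f (2 * t + 2) + 2 ≤ k)

/-- The overpartitions counted by `F_{k,i}`: those counted by `O_{k,i}` whose smallest part (if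
there is any part) is an overlined odd part or a non-overlined even part. -/
def IsF (k i : ℕ) (l : Overpartition) : Prop :=
  l.IsO k i ∧ ∀ a ∈ l.parts.head?,
    (Odd a.size ∧ a.overlined = true) ∨ (Even a.size ∧ a.overlined = false)

end Overpartition

/-- `F_{N₁,…,N_{k-1};i}`; here `N r` with `r : Fin (k - 1)` stands for `N_{r+1}`. -/
def setF (k i : ℕ) (N : Fin (k - 1) → ℕ) : Set Overpartition :=
  {l | l.IsF k i ∧ ∀ r : Fin (k - 1), l.numMarked ((r : ℕ) + 1) = N r}

/-- `G_{N₁,…,N_{k-1};i}`: no overlined even parts and no non-overlined odd parts. -/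
def setG (k i : ℕ) (N : Fin (k - 1) → ℕ) : Set Overpartition :=
  {l | l ∈ setF k i N ∧ (∀ a ∈ l.parts, ¬ (Even a.size ∧ a.overlined = true)) ∧
    (∀ a ∈ l.parts, ¬ (Odd a.size ∧ a.overlined = false))}

/-- `E_{N₁,…,N_{k-1};i}`: moreover no overlined odd parts. -/
def setE (k i : ℕ) (N : Fin (k - 1) → ℕ) : Set Overpartition :=
  {l | l ∈ setG k i N ∧ ∀ a ∈ l.parts, ¬ (Odd a.size ∧ a.overlined = true)}

/-- `N₁`, which is `0` if there are no entries (`k = 1`). -/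
def firstEntry (k : ℕ) (N : Fin (k - 1) → ℕ) : ℕ :=
  if h : 0 < k - 1 then N ⟨0, h⟩ else 0

/-- `D_M`: the partitions into distinct negative odd parts in `[1 - 2M, -1]`, as sets of parts. -/
def setD (M : ℕ) : Set (Finset ℤ) :=
  {η | ∀ x ∈ η, Odd x ∧ 1 - 2 * (M : ℤ) ≤ x ∧ x ≤ -1}

/-- The monomial `q ^ m`, `m ∈ ℤ`, as a formal Laurent series. -/
noncomputable def qpow (m : ℤ) : LaurentSeries ℤ := HahnSeries.single m 1

/-- `(a; b)_n = ∏_{j < n} (1 - a b ^ j)`. -/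
noncomputable def qPochhammer (a b : LaurentSeries ℤ) (n : ℕ) : LaurentSeries ℤ :=
  ∏ j ∈ Finset.range n, (1 - a * b ^ j)

/-- The generating function `∑_{l ∈ S} q ^ |l|` of a set of overpartitions with finitely many
members of each size. -/
noncomputable def genFun (S : Set Overpartition) : LaurentSeries ℤ :=
  ((PowerSeries.mk (fun n : ℕ => ((Set.ncard {l ∈ S | l.size = n} : ℕ) : ℤ)) : PowerSeries ℤ) :
    LaurentSeries ℤ)

end GollnitzGordon

/-!
Overpartitions whose overlined parts are exactly the odd ones are encoded by frequency sequences
`Freq`. On them the exceptional rule of the Göllnitz–Gordon marking never applies, and the marking is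
a first-fit colouring: `2t` and `2t + 2`, `2t` and `2t + 1`, `2t + 1` and `2t + 2` receive different
marks, and so do equal parts. In particular the upper bounds `k - 1` on neighbouring frequencies say
that no mark exceeds `k - 1` (`Freq.numMarked_eq_zero_iff`).

The bijection removes the odd parts one by one, beginning with the largest. If `2t + 1` is the largest
odd part and `p - 1` parts marked `1` exceed it, the step replaces `2t + 1` by `2t + 2` and each of
these `p - 1` parts `2s` by `2s + 2` (`Freq.IsStep`). The size grows by `2p - 1`, and the recorded
part of `η` is `1 - 2p`.

A step keeps the number of parts with any given mark (`Freq.IsStep.numMarked_eq`). Going upwards, the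
set of the marks of `2s` changes by at most one element: a mark lost at `2s` is gained at `2s + 2`
(`Freq.IsStep.compare`).

A step is reversible. Let `U` consist of `t` and of the `s` for which a part `2s` moves. Before
the step, `U` is found from below: `s + 1` belongs to it if `2s + 2` occurs and `s` does not belong to
it. After the step, `U` is found from above: `s` belongs to it if `2s + 2` occurs and `s + 1` does not
belong to it. This second recursion determines `U` once its cardinality `p` is known
(`Freq.IsStep.left_unique`), and it allows every `p` smaller than the rank of the result
(`Freq.exists_isStep_right`). The ranks `p` of successive steps increase (`Freq.IsStep.rank_lt`) and
are at most the number `N₁` of the parts marked `1`, so that the recorded numbers form an arbitrary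
element of `D` (`Freq.exists_split_eq`).

The identity of generating functions follows by counting both sides of the bijection, since the
product `(-q^{1-2M}; q²)_M` is the sum of `q^|η|` over `D_M` (`qPochhammer_eq`).
-/

namespace GollnitzGordon

/-! ### First-fit marks -/

theorem leastUnused_pos (S : List ℕ) : 0 < leastUnused S := (Nat.find_spec (exists_unused S)).1

theorem leastUnused_notMem (S : List ℕ) : leastUnused S ∉ S :=
  (Nat.find_spec (exists_unused S)).2

theorem mem_of_lt_leastUnused {S : List ℕ} {y : ℕ} (hy : 0 < y) (h : y < leastUnused S) :
    y ∈ S := by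
  by_contra hn
  exact Nat.find_min (exists_unused S) h ⟨hy, hn⟩

/-- The least positive integer outside a finite set. -/
noncomputable def mex (S : Finset ℕ) : ℕ := leastUnused S.toList

theorem mex_pos (S : Finset ℕ) : 0 < mex S := leastUnused_pos _

theorem mex_notMem (S : Finset ℕ) : mex S ∉ S := fun h =>
  leastUnused_notMem S.toList (Finset.mem_toList.2 h)

theorem mem_of_lt_mex {S : Finset ℕ} {y : ℕ} (hy : 0 < y) (h : y < mex S) : y ∈ S :=
  Finset.mem_toList.1 (mem_of_lt_leastUnused hy h)

theorem leastUnused_eq_mex {L : List ℕ} {S : Finset ℕ} (h : ∀ m, m ∈ L ↔ m ∈ S) :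
    leastUnused L = mex S := by
  apply le_antisymm
  · by_contra! hlt
    exact mex_notMem S ((h _).1 (mem_of_lt_leastUnused (mex_pos S) hlt))
  · by_contra! hlt
    exact leastUnused_notMem L ((h _).2 (mem_of_lt_mex (leastUnused_pos L) hlt))

theorem mex_le (S : Finset ℕ) : mex S ≤ S.card + 1 := by
  have h : Finset.Ioo 0 (mex S) ⊆ S := fun y hy => by
    rw [Finset.mem_Ioo] at hy
    exact mem_of_lt_mex hy.1 hy.2
  have := Finset.card_le_card h
  rw [Nat.card_Ioo] at this
  omega

/-- `A` consists of the first few positive integers outside `S`. -/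
structure IsFirst (S A : Finset ℕ) : Prop where
  pos : ∀ x ∈ A, 0 < x
  disj : ∀ x ∈ A, x ∉ S
  initial : ∀ x ∈ A, ∀ y, 0 < y → y < x → y ∈ S ∨ y ∈ A

theorem IsFirst.eq_of_card_eq {S A B : Finset ℕ} (hA : IsFirst S A) (hB : IsFirst S B)
    (h : A.card = B.card) : A = B := by
  by_cases hAB : A ⊆ B
  · exact Finset.eq_of_subset_of_card_le hAB h.ge
  · obtain ⟨x, hxA, hxB⟩ := Finset.not_subset.1 hAB
    refine (Finset.eq_of_subset_of_card_le (fun y hy => ?_) h.le).symm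
    by_contra hyA
    rcases lt_trichotomy x y with hlt | rfl | hlt
    · rcases hB.initial y hy x (hA.pos x hxA) hlt with h1 | h1
      · exact hA.disj x hxA h1
      · exact hxB h1
    · exact hxB hy
    · rcases hA.initial x hxA y (hB.pos y hy) hlt with h1 | h1
      · exact hB.disj y hy h1
      · exact hyA h1

/-- The first `n` positive integers outside `S`. -/
noncomputable def greedy (S : Finset ℕ) : ℕ → Finset ℕ
  | 0 => ∅
  | n + 1 => insert (mex (S ∪ greedy S n)) (greedy S n)

theorem isFirst_greedy (S : Finset ℕ) (n : ℕ) : IsFirst S (greedy S n) := by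
  induction n with
  | zero => constructor <;> simp [greedy]
  | succ n ih =>
    have h1 := mex_pos (S ∪ greedy S n)
    have h2 := mex_notMem (S ∪ greedy S n)
    have h3 := fun y hy => mem_of_lt_mex (S := S ∪ greedy S n) (y := y) hy
    simp only [Finset.mem_union, not_or] at h2 h3
    constructor
    · simp only [greedy, Finset.mem_insert]
      rintro x (rfl | hx)
      exacts [h1, ih.pos x hx]
    · simp only [greedy, Finset.mem_insert]
      rintro x (rfl | hx)
      exacts [h2.1, ih.disj x hx]
    · simp only [greedy, Finset.mem_insert]
      rintro x (rfl | hx) y hy hyx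
      · exact (h3 y hy hyx).imp_right Or.inr
      · exact (ih.initial x hx y hy hyx).imp_right Or.inr

theorem card_greedy (S : Finset ℕ) (n : ℕ) : (greedy S n).card = n := by
  induction n with
  | zero => rfl
  | succ n ih =>
    have h2 := mex_notMem (S ∪ greedy S n)
    rw [greedy, Finset.card_insert_of_notMem (fun h => h2 (Finset.mem_union_right _ h)), ih]

theorem IsFirst.eq_greedy {S A : Finset ℕ} (h : IsFirst S A) {n : ℕ} (hn : A.card = n) :
    A = greedy S n :=
  h.eq_of_card_eq (isFirst_greedy S n) (hn.trans (card_greedy S n).symm)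

theorem one_mem_greedy {S : Finset ℕ} {n : ℕ} : 1 ∈ greedy S n ↔ 0 < n ∧ 1 ∉ S := by
  have hf := isFirst_greedy S n
  constructor
  · intro h
    refine ⟨?_, hf.disj 1 h⟩
    rw [← card_greedy S n]
    exact Finset.card_pos.2 ⟨1, h⟩
  · rintro ⟨hn, hS⟩
    rw [← card_greedy S n] at hn
    obtain ⟨x, hx⟩ := Finset.card_pos.1 hn
    rcases (Nat.succ_le_of_lt (hf.pos x hx)).lt_or_eq with hlt | heq
    · exact (hf.initial x hx 1 one_pos hlt).resolve_left hS
    · rwa [← heq] at hx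

theorem le_of_mem_greedy {S : Finset ℕ} {n x : ℕ} (hx : x ∈ greedy S n) : x ≤ S.card + n := by
  have hf := isFirst_greedy S n
  have h : Finset.Ioc 0 x ⊆ S ∪ greedy S n := fun y hy => by
    rw [Finset.mem_Ioc] at hy
    rw [Finset.mem_union]
    rcases hy.2.lt_or_eq with hlt | rfl
    exacts [hf.initial x hx y hy.1 hlt, Or.inr hx]
  have h1 := (Finset.card_le_card h).trans (Finset.card_union_le _ _)
  rw [Nat.card_Ioc, card_greedy] at h1
  omega

/-! ### Frequency sequences and their marks -/

/-- The frequencies of an overpartition without overlined even and without non-overlined odd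
parts: `even t` is the number of parts `2t`, and `odd` is the set of those `t` for which the
overlined part `2t + 1` occurs. -/
@[ext]
structure Freq where
  even : ℕ →₀ ℕ
  odd : Finset ℕ
  even_zero : even 0 = 0

namespace Freq

/-- The set of the marks of the parts `2t`. Equal parts have different marks. -/
noncomputable def marks (f : Freq) : ℕ → Finset ℕ
  | 0 => ∅
  | t + 1 => greedy (if t ∈ f.odd then insert (mex (f.marks t)) (f.marks t) else f.marks t)
      (f.even (t + 1))

/-- The marks not available to the parts `2t + 2`: those of the parts `2t` and `2t + 1`. -/
noncomputable def blocked (f : Freq) (t : ℕ) : Finset ℕ :=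
  if t ∈ f.odd then insert (mex (f.marks t)) (f.marks t) else f.marks t

theorem marks_succ (f : Freq) (t : ℕ) :
    f.marks (t + 1) = greedy (f.blocked t) (f.even (t + 1)) := rfl

theorem card_marks (f : Freq) (t : ℕ) : (f.marks t).card = f.even t := by
  cases t with
  | zero => simp [marks, f.even_zero]
  | succ t => rw [marks_succ, card_greedy]

theorem isFirst_marks (f : Freq) (t : ℕ) : IsFirst (f.blocked t) (f.marks (t + 1)) :=
  isFirst_greedy _ _

theorem marks_pos {f : Freq} {t m : ℕ} (h : m ∈ f.marks t) : 0 < m := by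
  cases t with
  | zero => simp [marks] at h
  | succ t => exact (f.isFirst_marks t).pos m h

theorem one_mem_blocked {f : Freq} {t : ℕ} (h : t ∈ f.odd) : 1 ∈ f.blocked t := by
  rw [blocked, if_pos h, Finset.mem_insert]
  by_cases h1 : 1 ∈ f.marks t
  · exact Or.inr h1
  · left
    by_contra hne
    have := mex_pos (f.marks t)
    exact h1 (mem_of_lt_mex one_pos (by omega))

theorem one_mem_marks_succ {f : Freq} {t : ℕ} :
    1 ∈ f.marks (t + 1) ↔ 0 < f.even (t + 1) ∧ t ∉ f.odd ∧ 1 ∉ f.marks t := by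
  rw [marks_succ, one_mem_greedy]
  by_cases h : t ∈ f.odd
  · simp [h, one_mem_blocked h]
  · simp [h, blocked]

theorem marks_congr {f g : Freq} {t : ℕ} (he : ∀ s ≤ t, f.even s = g.even s)
    (ho : ∀ s < t, s ∈ f.odd ↔ s ∈ g.odd) : f.marks t = g.marks t := by
  induction t with
  | zero => rfl
  | succ t ih =>
    simp only [marks, he (t + 1) le_rfl, ho t (Nat.lt_succ_self t),
      ih (fun s hs => he s (by omega)) (fun s hs => ho s (by omega))]

/-- The number of the parts of size less than `2T` that have the mark `r`. -/
noncomputable def count (f : Freq) (r T : ℕ) : ℕ :=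
  ∑ t ∈ Finset.range T,
    ((if r ∈ f.marks t then 1 else 0) + if t ∈ f.odd ∧ mex (f.marks t) = r then 1 else 0)

/-- All parts have sizes less than `2 * f.bound`. -/
def bound (f : Freq) : ℕ := (f.even.support ∪ f.odd).sup (· + 1)

theorem even_eq_zero {f : Freq} {t : ℕ} (h : f.bound ≤ t) : f.even t = 0 := by
  by_contra hne
  have : t + 1 ≤ f.bound := Finset.le_sup (f := (· + 1))
    (Finset.mem_union_left _ (Finsupp.mem_support_iff.2 hne))
  omega

theorem lt_bound_of_mem_odd {f : Freq} {t : ℕ} (h : t ∈ f.odd) : t < f.bound :=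
  Finset.le_sup (f := (· + 1)) (Finset.mem_union_right _ h)

theorem marks_eq_empty {f : Freq} {t : ℕ} (h : f.even t = 0) : f.marks t = ∅ := by
  rw [← Finset.card_eq_zero, card_marks, h]

/-- The number of the parts that have the mark `r`. -/
noncomputable def numMarked (f : Freq) (r : ℕ) : ℕ := f.count r f.bound

theorem count_eq_numMarked {f : Freq} (r : ℕ) {T : ℕ} (h : f.bound ≤ T) :
    f.count r T = f.numMarked r := by
  refine (Finset.sum_subset (Finset.range_subset_range.2 h) fun t _ ht => ?_).symm
  rw [Finset.mem_range, not_lt] at ht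
  have : t ∉ f.odd := fun h => absurd (lt_bound_of_mem_odd h) (by omega)
  simp [marks_eq_empty (even_eq_zero ht), this]

theorem count_succ (f : Freq) (r T : ℕ) : f.count r (T + 1) = f.count r T +
    ((if r ∈ f.marks T then 1 else 0) + if T ∈ f.odd ∧ mex (f.marks T) = r then 1 else 0) :=
  Finset.sum_range_succ _ _

theorem count_congr {f g : Freq} {r T : ℕ} (he : ∀ s < T, f.even s = g.even s)
    (ho : ∀ s < T, s ∈ f.odd ↔ s ∈ g.odd) : f.count r T = g.count r T := by
  refine Finset.sum_congr rfl fun t ht => ?_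
  rw [Finset.mem_range] at ht
  rw [marks_congr (fun s hs => he s (by omega)) (fun s hs => ho s (by omega))]
  simp only [ho t ht]

/-! ### Removing the largest odd part -/

/-- The frequency sequence `g` arises from `f` by removing its largest odd part: this part
`2t + 1` is replaced by `2t + 2`, and for each `s ∈ U` with `s > t` one part `2s` is
replaced by `2s + 2`. Here `U` consists of `t` and of the `s > t` for which `2s` has the mark `1`
in `f`; it is described by the recursion that these `s` obey. -/
structure IsStep (f g : Freq) (t : ℕ) (U : Finset ℕ) : Prop where
  mem_odd : t ∈ f.odd
  le_of_mem_odd : ∀ s ∈ f.odd, s ≤ t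
  odd_eq : g.odd = f.odd.erase t
  mem : t ∈ U
  le_of_mem : ∀ s ∈ U, t ≤ s
  even_low : ∀ s ≤ t, g.even s = f.even s
  even_high : ∀ s, t ≤ s → g.even (s + 1) + (if s + 1 ∈ U then 1 else 0) =
    f.even (s + 1) + if s ∈ U then 1 else 0
  succ_mem : ∀ s, t ≤ s → (s + 1 ∈ U ↔ 0 < f.even (s + 1) ∧ s ∉ U)

namespace IsStep

variable {f g : Freq} {t : ℕ} {U : Finset ℕ}

theorem notMem_odd (h : IsStep f g t U) {s : ℕ} (hs : t < s) : s ∉ f.odd := fun hm =>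
  absurd (h.le_of_mem_odd s hm) (by omega)

theorem notMem_odd_right (h : IsStep f g t U) {s : ℕ} (hs : t ≤ s) : s ∉ g.odd := by
  rw [h.odd_eq, Finset.mem_erase]
  rintro ⟨hne, hm⟩
  exact hne (le_antisymm (h.le_of_mem_odd s hm) hs)

/-- Past the removed odd part, the moved parts are exactly those marked `1`. -/
theorem mem_iff (h : IsStep f g t U) {s : ℕ} (hs : t < s) : s ∈ U ↔ 1 ∈ f.marks s := by
  obtain ⟨s, rfl⟩ : ∃ s', s = s' + 1 := ⟨s - 1, by omega⟩
  replace hs : t ≤ s := by omega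
  induction s, hs using Nat.le_induction with
  | base => rw [h.succ_mem _ le_rfl, one_mem_marks_succ]; simp [h.mem_odd, h.mem]
  | succ s hs ih =>
    have ih' : s + 1 ∈ U ↔ 1 ∈ f.marks (s + 1) := ih
    rw [h.succ_mem _ (by omega), one_mem_marks_succ]
    simp [h.notMem_odd (s := s + 1) (by omega), ih']

/-- The set `U` is determined by `g` and its least element, through a recursion from above. -/
theorem mem_iff_right (h : IsStep f g t U) {s : ℕ} (hs : t ≤ s) :
    s ∈ U ↔ 0 < g.even (s + 1) ∧ s + 1 ∉ U := by
  have h1 := h.even_high s hs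
  have h2 := h.succ_mem s hs
  by_cases hU : s ∈ U <;> by_cases hU' : s + 1 ∈ U <;> simp [hU, hU'] at h1 h2 ⊢ <;> omega

/-- The comparison of the marks before and after a step. Past the removed odd part, the parts of
a given size lose at most one mark or gain at most one. If `2s + 2` loses a part, the lost mark `c`
is such that all of `1, …, c` were marks of `2s + 2`, so that none of them occurs at `2s + 4` in
`f`, and `2s + 4` gains precisely the mark `c`. If `2s + 2` gains a part, the gained mark `e` is
below all its other marks; if `2s + 4` then loses a part, either it gives up the mark `e`, or its
marks are `1, …, c` with `c < e` and it gives up the largest one; the latter also happens after a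
size that does not occur. The counts of the marks
therefore agree, except between the loss of a mark and the gain that makes up for it. -/
theorem compare (h : IsStep f g t U) {s : ℕ} (hs : t ≤ s) :
    (s + 1 ∈ U ∧ ∃ c, 0 < c ∧ (∀ y, 0 < y → y ≤ c → y ∈ f.marks (s + 1)) ∧
      g.marks (s + 1) = (f.marks (s + 1)).erase c ∧
      ∀ r, f.count r (s + 2) = g.count r (s + 2) + if r = c then 1 else 0) ∨
    (s ∈ U ∧ ∃ e, 0 < e ∧ (∀ y ≤ e, y ∉ f.marks (s + 1)) ∧
      g.marks (s + 1) = insert e (f.marks (s + 1)) ∧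
      ∀ r, f.count r (s + 2) = g.count r (s + 2)) ∨
    (s ∉ U ∧ s + 1 ∉ U ∧ f.marks (s + 1) = ∅ ∧ g.marks (s + 1) = ∅ ∧
      ∀ r, f.count r (s + 2) = g.count r (s + 2)) := by
  have hmarks : ∀ s ≤ t, g.marks s = f.marks s := fun s hs =>
    marks_congr (fun x hx => h.even_low x (by omega)) fun x hx => by
      rw [h.odd_eq, Finset.mem_erase]; exact ⟨And.right, fun h => ⟨by omega, h⟩⟩
  have hgb : ∀ s, t ≤ s → g.blocked s = g.marks s := fun s hs => by
    rw [blocked, if_neg (h.notMem_odd_right hs)]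
  have hfb : ∀ s, t < s → f.blocked s = f.marks s := fun s hs => by
    rw [blocked, if_neg (h.notMem_odd hs)]
  have hcf : ∀ r s, t ≤ s → f.count r (s + 2) = f.count r (s + 1) +
      (if r ∈ f.marks (s + 1) then 1 else 0) := fun r s hs => by
    rw [count_succ]; simp [h.notMem_odd (s := s + 1) (by omega)]
  have hcg : ∀ r s, t ≤ s → g.count r (s + 1) = g.count r s +
      (if r ∈ g.marks s then 1 else 0) := fun r s hs => by
    rw [count_succ]; simp [h.notMem_odd_right hs]
  induction s, hs using Nat.le_induction with
  | base =>
    -- the odd part hands its mark over to the new part `2t + 2`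
    right; left
    have hF := f.isFirst_marks t
    rw [blocked, if_pos h.mem_odd] at hF
    have h1 : ∀ y ≤ mex (f.marks t), y ∉ f.marks (t + 1) := fun y hy hm => by
      refine hF.disj y hm (Finset.mem_insert.2 ?_)
      rcases hy.lt_or_eq with hlt | rfl
      exacts [Or.inr (mem_of_lt_mex (hF.pos y hm) hlt), Or.inl rfl]
    have hg : g.marks (t + 1) = insert (mex (f.marks t)) (f.marks (t + 1)) := by
      rw [marks_succ, hgb t le_rfl, hmarks t le_rfl]
      refine (IsFirst.eq_greedy ?_ ?_).symm
      · have hp := mex_pos (f.marks t)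
        have hn := mex_notMem (f.marks t)
        have hl := fun y => mem_of_lt_mex (S := f.marks t) (y := y)
        have a1 := hF.pos
        have a2 := hF.disj
        have a3 := hF.initial
        constructor <;> simp only [Finset.mem_insert] at * <;> grind
      · have e1 := h.even_high t le_rfl
        have e2 := h.succ_mem t le_rfl
        simp only [h.mem, not_true_eq_false, and_false, iff_false] at e2
        simp only [e2, h.mem, if_false, if_true] at e1
        rw [Finset.card_insert_of_notMem (h1 _ le_rfl), card_marks]
        omega
    refine ⟨h.mem, _, mex_pos _, h1, hg, fun r => ?_⟩
    rw [hcf r t le_rfl, hcg r (t + 1) (by omega), hcg r t le_rfl, count_succ, hmarks t le_rfl, hg,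
      count_congr (g := g) (fun s hs => (h.even_low s (by omega)).symm) (fun s hs => by
        rw [h.odd_eq, Finset.mem_erase]; exact ⟨fun h => ⟨by omega, h⟩, And.right⟩)]
    have := h1 _ le_rfl
    simp only [h.mem_odd, Finset.mem_insert, true_and]
    by_cases hr : r = mex (f.marks t)
    · subst hr; simp [this, add_assoc]
    · simp [hr, Ne.symm hr]
  | succ s hs ih =>
    have hF := f.isFirst_marks (s + 1)
    rw [hfb (s + 1) (by omega)] at hF
    have a1 := hF.pos
    have a2 := hF.disj
    have a3 := hF.initial
    have e1 : g.even (s + 2) + (if s + 2 ∈ U then 1 else 0) =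
        f.even (s + 2) + if s + 1 ∈ U then 1 else 0 := h.even_high (s + 1) (by omega)
    have e2 : s + 2 ∈ U ↔ 0 < f.even (s + 2) ∧ s + 1 ∉ U := h.succ_mem (s + 1) (by omega)
    have e3 := h.succ_mem s hs
    have hgm : ∀ A : Finset ℕ, IsFirst (g.marks (s + 1)) A → A.card = g.even (s + 2) →
        g.marks (s + 2) = A := fun A hA hc => by
      rw [marks_succ, hgb (s + 1) (by omega), ← hA.eq_greedy hc]
    have hcard := f.card_marks (s + 2)
    simp only [hcf _ (s + 1) (show t ≤ s + 1 by omega), hcg _ (s + 2) (show t ≤ s + 2 by omega)]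
    -- a part `2s + 4` is moved up and its marks lose `c`
    have conclude : s + 2 ∈ U → g.even (s + 2) + 1 = f.even (s + 2) → ∀ c, 0 < c →
        (∀ y, 0 < y → y ≤ c → y ∈ f.marks (s + 2)) →
        IsFirst (g.marks (s + 1)) ((f.marks (s + 2)).erase c) →
        (∀ r, f.count r (s + 2) = g.count r (s + 2)) →
        (s + 2 ∈ U ∧ ∃ c, 0 < c ∧ (∀ y, 0 < y → y ≤ c → y ∈ f.marks (s + 2)) ∧
          g.marks (s + 2) = (f.marks (s + 2)).erase c ∧
          ∀ r, f.count r (s + 2) + (if r ∈ f.marks (s + 2) then 1 else 0) =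
            g.count r (s + 2) + (if r ∈ g.marks (s + 2) then 1 else 0) +
              if r = c then 1 else 0) := fun hU he c hc hle hfirst hcount => by
      have hcM := hle c hc le_rfl
      have hgm' := hgm _ hfirst (by rw [Finset.card_erase_of_mem hcM]; omega)
      refine ⟨hU, c, hc, hle, hgm', fun r => ?_⟩
      rw [hgm', hcount r]
      by_cases hr : r = c
      · subst hr; simp [hcM]
      · simp [hr]
    rcases ih with ⟨hU, c, hc, hc1, hg, hcount⟩ | ⟨hU, e, he, hfe, hg, hcount⟩ |
      ⟨hU, hU', hf0, hg0, hcount⟩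
    · right; left
      have hU2 : s + 2 ∉ U := fun hm => (e2.1 hm).2 hU
      simp only [hU, hU2, if_true, if_false] at e1
      have hcm : ∀ y ≤ c, y ∉ f.marks (s + 2) := fun y hy hm => a2 y hm (hc1 y (a1 y hm) hy)
      have hgm' := hgm (insert c (f.marks (s + 2)))
        (by rw [hg]; constructor <;> simp only [Finset.mem_insert, Finset.mem_erase] <;> grind)
        (by rw [Finset.card_insert_of_notMem (hcm c le_rfl)]; omega)
      refine ⟨hU, c, hc, hcm, hgm', fun r => ?_⟩
      rw [hgm', hcount r]
      have := hcm c le_rfl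
      by_cases hr : r = c
      · subst hr; simp [this]
      · simp [hr]
    · have hU2 : s + 1 ∉ U := fun hm => (e3.1 hm).2 hU
      by_cases h0 : f.even (s + 2) = 0
      · right; right
        have hU3 : s + 2 ∉ U := fun hm => absurd (e2.1 hm).1 (by omega)
        simp only [hU2, hU3, if_false] at e1
        have g0 : g.marks (s + 2) = ∅ := marks_eq_empty (by omega)
        refine ⟨hU2, hU3, marks_eq_empty h0, g0, fun r => ?_⟩
        rw [g0, marks_eq_empty h0, hcount r]
      · left
        have hU3 : s + 2 ∈ U := e2.2 ⟨by omega, hU2⟩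
        simp only [hU2, hU3, if_true, if_false] at e1
        -- the given up mark is `e` if present, and the largest mark otherwise
        by_cases heM : e ∈ f.marks (s + 2)
        · have hle : ∀ y, 0 < y → y ≤ e → y ∈ f.marks (s + 2) := fun y hy hye => by
            rcases hye.lt_or_eq with hlt | rfl
            exacts [(a3 e heM y hy hlt).resolve_left (hfe y hye), heM]
          exact conclude hU3 (by omega) e he hle
            (by rw [hg]; constructor <;> simp only [Finset.mem_insert, Finset.mem_erase] <;> grind)
            hcount
        · obtain ⟨c, hcM, hmax⟩ := (f.marks (s + 2)).exists_max_image id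
            (Finset.card_pos.1 (by omega))
          simp only [id] at hmax
          have hlt : ∀ x ∈ f.marks (s + 2), x < e := fun x hx => by
            by_contra! hex
            rcases hex.lt_or_eq with hlt | rfl
            exacts [(a3 x hx e he hlt).elim (hfe e le_rfl) heM, heM hx]
          have hle : ∀ y, 0 < y → y ≤ c → y ∈ f.marks (s + 2) := fun y hy hyc => by
            rcases hyc.lt_or_eq with hlt' | rfl
            exacts [(a3 c hcM y hy hlt').resolve_left (hfe y (hlt'.trans (hlt c hcM)).le), hcM]
          exact conclude hU3 (by omega) c (a1 c hcM) hle
            (by rw [hg]; constructor <;> simp only [Finset.mem_insert, Finset.mem_erase] <;> grind)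
            hcount
    · by_cases h0 : f.even (s + 2) = 0
      · right; right
        have hU3 : s + 2 ∉ U := fun hm => absurd (e2.1 hm).1 (by omega)
        simp only [hU', hU3, if_false] at e1
        have g0 : g.marks (s + 2) = ∅ := marks_eq_empty (by omega)
        refine ⟨hU', hU3, marks_eq_empty h0, g0, fun r => ?_⟩
        rw [g0, marks_eq_empty h0, hcount r]
      · left
        have hU3 : s + 2 ∈ U := e2.2 ⟨by omega, hU'⟩
        simp only [hU', hU3, if_true, if_false] at e1
        obtain ⟨c, hcM, hmax⟩ := (f.marks (s + 2)).exists_max_image id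
          (Finset.card_pos.1 (by omega))
        simp only [id] at hmax
        rw [hf0] at a3
        have hle : ∀ y, 0 < y → y ≤ c → y ∈ f.marks (s + 2) := fun y hy hyc => by
          rcases hyc.lt_or_eq with hlt' | rfl
          exacts [(a3 c hcM y hy hlt').resolve_left (Finset.notMem_empty y), hcM]
        exact conclude hU3 (by omega) c (a1 c hcM) hle
          (by rw [hg0]; constructor <;> simp only [Finset.mem_erase] <;> grind) hcount

end IsStep

/-- The least `T` such that all odd parts have sizes less than `2T`. -/
def top (f : Freq) : ℕ := f.odd.sup (· + 1)

theorem lt_top_of_mem {f : Freq} {s : ℕ} (hs : s ∈ f.odd) : s < f.top :=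
  Finset.le_sup (f := (· + 1)) hs

/-- The `s ≥ T` such that one of the parts `2s` has the mark `1`. -/
noncomputable def ones (f : Freq) (T : ℕ) : Finset ℕ :=
  f.even.support.filter fun s => T ≤ s ∧ 1 ∈ f.marks s

theorem mem_ones {f : Freq} {T s : ℕ} : s ∈ f.ones T ↔ T ≤ s ∧ 1 ∈ f.marks s := by
  rw [ones, Finset.mem_filter, Finsupp.mem_support_iff, and_iff_right_iff_imp]
  rintro ⟨-, h⟩ h0
  simp [marks_eq_empty h0] at h

/-- One more than the number of the parts marked `1` that exceed all odd parts. -/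
noncomputable def rank (f : Freq) : ℕ := (f.ones f.top).card + 1

theorem numMarked_one {f : Freq} {T : ℕ} (hT : f.top ≤ T) :
    f.numMarked 1 = f.count 1 T + (f.ones T).card := by
  rw [← count_eq_numMarked 1 (le_max_right T f.bound), count,
    ← Finset.sum_range_add_sum_Ico _ (le_max_left T f.bound), count, add_right_inj]
  have : f.ones T = (Finset.Ico T (max T f.bound)).filter fun s => 1 ∈ f.marks s := by
    ext s
    rw [mem_ones, Finset.mem_filter, Finset.mem_Ico]
    refine ⟨fun h => ⟨⟨h.1, ?_⟩, h.2⟩, fun h => ⟨h.1.1, h.2⟩⟩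
    by_contra! hb
    have := h.2
    rw [marks_eq_empty (even_eq_zero ((le_max_right _ _).trans hb))] at this
    simp at this
  rw [this, Finset.card_filter]
  refine Finset.sum_congr rfl fun s hs => ?_
  have : s ∉ f.odd := fun h => by
    have := lt_top_of_mem h
    have := (Finset.mem_Ico.1 hs).1
    omega
  simp [this]

theorem rank_le (f : Freq) : f.rank ≤ f.numMarked 1 + 1 := by
  rw [numMarked_one le_rfl, rank]; omega

theorem rank_of_odd_eq_empty {f : Freq} (h : f.odd = ∅) : f.rank = f.numMarked 1 + 1 := by
  have ht : f.top = 0 := by simp [top, h]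
  rw [numMarked_one le_rfl, rank, ht]; simp [count]

/-- The sum of the sizes of the parts of size less than `2T`. -/
def sizeBelow (f : Freq) (T : ℕ) : ℕ :=
  ∑ t ∈ Finset.range T, (2 * t * f.even t + if t ∈ f.odd then 2 * t + 1 else 0)

/-- The sum of the sizes of the parts. -/
def size (f : Freq) : ℕ := f.sizeBelow f.bound

theorem sizeBelow_eq_size {f : Freq} {T : ℕ} (h : f.bound ≤ T) : f.sizeBelow T = f.size := by
  refine (Finset.sum_subset (Finset.range_subset_range.2 h) fun t _ ht => ?_).symm
  rw [Finset.mem_range, not_lt] at ht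
  have : t ∉ f.odd := fun h => absurd (lt_bound_of_mem_odd h) (by omega)
  simp [even_eq_zero ht, this]

/-- The number of the parts of sizes `1` and `2`. -/
def initial (f : Freq) : ℕ := (if 0 ∈ f.odd then 1 else 0) + f.even 1

namespace IsStep

variable {f g : Freq} {t : ℕ} {U : Finset ℕ}

/-- A step preserves the number of parts with any given mark. -/
theorem numMarked_eq (h : IsStep f g t U) (r : ℕ) : f.numMarked r = g.numMarked r := by
  obtain ⟨B, hf, hg, ht⟩ : ∃ B, f.bound ≤ B ∧ g.bound ≤ B ∧ t ≤ B :=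
    ⟨max f.bound (max g.bound t), by simp, by simp, by simp⟩
  have hm : f.marks (B + 1) = ∅ := marks_eq_empty (even_eq_zero (by omega))
  rw [← count_eq_numMarked r (show f.bound ≤ B + 2 by omega),
    ← count_eq_numMarked r (show g.bound ≤ B + 2 by omega)]
  rcases h.compare ht with ⟨-, c, hc, hc1, -⟩ | ⟨-, -, -, -, -, hcount⟩ | ⟨-, -, -, -, hcount⟩
  · have := hc1 c hc le_rfl
    simp [hm] at this
  · exact hcount r
  · exact hcount r

theorem initial_eq (h : IsStep f g t U) : f.initial = g.initial := by
  rw [initial, initial, h.odd_eq]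
  rcases Nat.eq_zero_or_pos t with rfl | ht
  · have e1 := h.even_high 0 le_rfl
    have e2 := h.succ_mem 0 le_rfl
    simp only [h.mem, not_true_eq_false, and_false, iff_false, zero_add] at e2
    simp only [zero_add, e2, h.mem, if_false, if_true] at e1
    simp [h.mem_odd]
    omega
  · have : (0 : ℕ) ≠ t := by omega
    simp [this, h.even_low 1 ht]

/-- The effect of a step on the partial sums of the sizes. The summand with `s ∈ U` accounts for the
part that is moved across the threshold. -/
theorem sizeBelow_add (h : IsStep f g t U) {s : ℕ} (hs : t ≤ s) :
    g.sizeBelow (s + 1) + 2 * (s + 1) * (if s ∈ U then 1 else 0) + 1 =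
      f.sizeBelow (s + 1) + 2 * ∑ x ∈ Finset.range (s + 1), if x ∈ U then 1 else 0 := by
  induction s, hs using Nat.le_induction with
  | base =>
    have h1 : g.sizeBelow t = f.sizeBelow t := Finset.sum_congr rfl fun x hx => by
      rw [Finset.mem_range] at hx
      simp [h.even_low x hx.le, h.odd_eq, hx.ne]
    have h2 : (∑ x ∈ Finset.range t, if x ∈ U then 1 else 0) = 0 :=
      Finset.sum_eq_zero fun x hx => if_neg fun hU => by
        have := h.le_of_mem x hU
        have := Finset.mem_range.1 hx
        omega
    have h3 : t ∉ g.odd := h.notMem_odd_right le_rfl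
    rw [sizeBelow, sizeBelow, Finset.sum_range_succ, Finset.sum_range_succ, Finset.sum_range_succ,
      ← sizeBelow, ← sizeBelow, h1, h2, h.even_low t le_rfl, if_pos h.mem, if_pos h.mem_odd,
      if_neg h3]
    ring
  | succ s hs ih =>
    have h1 := h.notMem_odd (s := s + 1) (by omega)
    have h2 := h.notMem_odd_right (s := s + 1) (by omega)
    have h3 := h.even_high s hs
    rw [sizeBelow, sizeBelow, Finset.sum_range_succ, Finset.sum_range_succ _ (s + 1),
      Finset.sum_range_succ _ (s + 1), ← sizeBelow, ← sizeBelow, if_neg h1, if_neg h2]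
    have h4 := congrArg (2 * (s + 1) * ·) h3
    simp only [mul_add] at h4 ih ⊢
    nlinarith

/-- A step of rank `p` raises the size by `2p - 1`: by `1` for the odd part and by `2` for each of the
`p - 1` moved even parts. -/
theorem size_add_one (h : IsStep f g t U) : g.size + 1 = f.size + 2 * U.card := by
  obtain ⟨B, hf, hg, ht, hU⟩ : ∃ B, f.bound ≤ B ∧ g.bound ≤ B ∧ t ≤ B ∧ ∀ x ∈ U, x < B := by
    refine ⟨max (max f.bound g.bound) (max t (U.sup (· + 1))), by simp, by simp, by simp,
      fun x hx => ?_⟩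
    have : x + 1 ≤ U.sup (· + 1) := Finset.le_sup (f := (· + 1)) hx
    exact (Nat.lt_of_succ_le this).trans_le ((le_max_right _ _).trans (le_max_right _ _))
  have h1 := h.sizeBelow_add ht
  have hB : B ∉ U := fun hm => (hU B hm).false
  have hcard : (∑ x ∈ Finset.range (B + 1), if x ∈ U then 1 else 0) = U.card := by
    rw [← Finset.card_filter]
    congr 1
    ext x
    simp only [Finset.mem_filter, Finset.mem_range, and_iff_right_iff_imp]
    exact fun hx => (hU x hx).trans (Nat.lt_succ_self B)
  rw [sizeBelow_eq_size (by omega), sizeBelow_eq_size (by omega), if_neg hB, hcard] at h1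
  omega

theorem top_eq (h : IsStep f g t U) : f.top = t + 1 :=
  le_antisymm (Finset.sup_le fun s hs => Nat.succ_le_succ (h.le_of_mem_odd s hs))
    (lt_top_of_mem h.mem_odd)

theorem top_le (h : IsStep f g t U) : g.top ≤ t := Finset.sup_le fun s hs => by
  by_contra! hlt
  exact h.notMem_odd_right (by omega) hs

theorem card_eq_rank (h : IsStep f g t U) : U.card = f.rank := by
  have : U = insert t (f.ones (t + 1)) := by
    ext s
    rw [Finset.mem_insert, mem_ones]
    rcases lt_trichotomy s t with hlt | rfl | hlt
    · have := mt (h.le_of_mem s) (by omega)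
      simp only [this, false_iff]; omega
    · simp [h.mem]
    · rw [h.mem_iff hlt]
      exact ⟨fun h => Or.inr ⟨hlt, h⟩, fun h => h.elim (fun h => by omega) And.right⟩
  rw [this, rank, h.top_eq, Finset.card_insert_of_notMem]
  rw [mem_ones]; omega

/-- The ranks of successive steps increase: either the removed odd part has the mark `1`, or a smaller
part `2t`, which exceeds the remaining odd parts, has it. -/
theorem rank_lt (h : IsStep f g t U) : f.rank < g.rank := by
  have h1 := numMarked_one h.top_eq.le
  have h2 := numMarked_one (le_refl g.top)
  have h3 : g.count 1 g.top = f.count 1 g.top := by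
    have := h.top_le
    exact count_congr (fun s hs => h.even_low s (by omega)) fun s hs => by
      rw [h.odd_eq, Finset.mem_erase]; exact ⟨And.right, fun h => ⟨by omega, h⟩⟩
  have h4 : f.count 1 g.top ≤ f.count 1 t :=
    Finset.sum_le_sum_of_subset (Finset.range_subset_range.2 h.top_le)
  have h5 := f.count_succ 1 t
  have h6 : 1 ≤ (if 1 ∈ f.marks t then 1 else 0) +
      if t ∈ f.odd ∧ mex (f.marks t) = 1 then 1 else 0 := by
    have := one_mem_blocked h.mem_odd
    rw [blocked, if_pos h.mem_odd, Finset.mem_insert] at this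
    rcases this with h7 | h7
    · simp [h.mem_odd, ← h7]
    · simp [h7]
  have h7 := h.numMarked_eq 1
  rw [rank, rank, h.top_eq]
  omega

theorem rank_le_numMarked (h : IsStep f g t U) : f.rank ≤ f.numMarked 1 := by
  have := h.rank_lt
  have := g.rank_le
  have := h.numMarked_eq 1
  omega

variable {f' : Freq} {t' : ℕ} {U' : Finset ℕ}

/-- The recursion from above has at most one solution on the common range of two steps with the same
result. -/
theorem mem_congr (h : IsStep f g t U) (h' : IsStep f' g t' U') {s : ℕ} (hs : t ≤ s)
    (hs' : t' ≤ s) : s ∈ U ↔ s ∈ U' := by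
  obtain ⟨B, hB, hB'⟩ : ∃ B, (∀ x ∈ U, x < B) ∧ ∀ x ∈ U', x < B := by
    refine ⟨(U ∪ U').sup (· + 1), fun x hx => ?_, fun x hx => ?_⟩
    · exact Finset.le_sup (f := (· + 1)) (Finset.mem_union_left _ hx)
    · exact Finset.le_sup (f := (· + 1)) (Finset.mem_union_right _ hx)
  obtain ⟨n, hn⟩ : ∃ n, B ≤ s + n := ⟨B, by omega⟩
  induction n generalizing s with
  | zero => exact ⟨fun hm => absurd (hB s hm) (by omega), fun hm => absurd (hB' s hm) (by omega)⟩
  | succ n ih =>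
    rw [h.mem_iff_right hs, h'.mem_iff_right hs', ih (s := s + 1) (by omega) (by omega) (by omega)]

theorem least_le (h : IsStep f g t U) (h' : IsStep f' g t' U') (hr : U.card ≤ U'.card) :
    t' ≤ t := by
  by_contra! hlt
  have : U' ⊆ U.erase t := fun s hs => by
    have hs' := h'.le_of_mem s hs
    rw [Finset.mem_erase, h.mem_congr h' (by omega) hs']
    exact ⟨by omega, hs⟩
  have := Finset.card_le_card this
  rw [Finset.card_erase_of_mem h.mem] at this
  have := Finset.card_pos.2 ⟨t, h.mem⟩
  omega

/-- A step can be undone, given the rank. -/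
theorem left_unique (h : IsStep f g t U) (h' : IsStep f' g t' U') (hr : f.rank = f'.rank) :
    f = f' := by
  rw [← h.card_eq_rank, ← h'.card_eq_rank] at hr
  obtain rfl : t = t' := le_antisymm (h'.least_le h hr.ge) (h.least_le h' hr.le)
  have hU : ∀ s, s ∈ U ↔ s ∈ U' := fun s => by
    by_cases hs : t ≤ s
    · exact h.mem_congr h' hs hs
    · exact ⟨fun hm => absurd (h.le_of_mem s hm) hs, fun hm => absurd (h'.le_of_mem s hm) hs⟩
  ext s
  · rcases Nat.lt_or_ge t s with hs | hs
    · obtain ⟨s, rfl⟩ : ∃ s', s = s' + 1 := ⟨s - 1, by omega⟩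
      have h1 := h.even_high s (by omega)
      have h2 := h'.even_high s (by omega)
      simp only [hU] at h1
      omega
    · rw [← h.even_low s hs, ← h'.even_low s hs]
  · have h1 := h.odd_eq.symm.trans h'.odd_eq
    rw [← Finset.insert_erase h.mem_odd, h1, Finset.insert_erase h'.mem_odd]

end IsStep

theorem exists_isStep {f : Freq} (hf : f.odd.Nonempty) : ∃ g t U, IsStep f g t U := by
  set t := f.odd.max' hf
  have hmem : t ∈ f.odd := Finset.max'_mem _ _
  have hle : ∀ s ∈ f.odd, s ≤ t := fun s hs => Finset.le_max' _ s hs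
  set U := insert t (f.ones (t + 1))
  have hU : ∀ s, s ∈ U ↔ s = t ∨ (t < s ∧ 1 ∈ f.marks s) := fun s => by
    rw [Finset.mem_insert, mem_ones, Nat.succ_le_iff]
  have hsucc : ∀ s, t ≤ s → (s + 1 ∈ U ↔ 0 < f.even (s + 1) ∧ s ∉ U) := fun s hs => by
    rw [hU, hU, one_mem_marks_succ]
    rcases hs.eq_or_lt with rfl | hlt
    · simp [hmem]
    · have : s ∉ f.odd := fun h => absurd (hle s h) (by omega)
      have h2 : s ≠ t := by omega
      have h3 : s + 1 ≠ t := by omega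
      have h4 : t < s + 1 := by omega
      simp [this, h2, h3, h4, hlt]
  let φ : ℕ → ℕ := fun s => if s ≤ t then f.even s else
    f.even s + (if s - 1 ∈ U then 1 else 0) - if s ∈ U then 1 else 0
  have hφ : ∀ s, φ s ≠ 0 → s ∈ f.even.support ∪ U.image (· + 1) := fun s hs => by
    by_contra hn
    simp only [Finset.mem_union, Finsupp.mem_support_iff, Finset.mem_image, not_or, not_exists,
      not_and, not_not] at hn
    have h1 : t < s → s - 1 ∉ U := fun hts hm => hn.2 _ hm (by omega)
    simp only [φ] at hs
    split_ifs at hs <;> simp_all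
  refine ⟨⟨Finsupp.onFinset _ φ hφ, f.odd.erase t, by simp [φ, f.even_zero]⟩, t, U, hmem, hle, rfl,
    (hU t).2 (Or.inl rfl), fun s hs => ?_, fun s hs => ?_, fun s hs => ?_, hsucc⟩
  · rcases (hU s).1 hs with rfl | h
    exacts [le_rfl, h.1.le]
  · simp [φ, hs]
  · have h1 : ¬ s + 1 ≤ t := by omega
    have h2 := hsucc s hs
    simp only [Finsupp.onFinset_apply, φ, h1, if_false, Nat.add_sub_cancel]
    by_cases h3 : s + 1 ∈ U
    · have := (h2.1 h3).1
      simp only [h3, if_true]; omega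
    · simp only [h3, if_false]; omega

/-- The recursion from above of `IsStep.mem_iff_right`, taken over all `s`, has a solution. -/
theorem exists_greedyFromAbove (g : Freq) :
    ∃ V : Finset ℕ, ∀ s, s ∈ V ↔ 0 < g.even (s + 1) ∧ s + 1 ∉ V := by
  suffices ∀ n m, n + m = g.bound → ∃ V : Finset ℕ, (∀ s ∈ V, m ≤ s) ∧
      ∀ s, m ≤ s → (s ∈ V ↔ 0 < g.even (s + 1) ∧ s + 1 ∉ V) by
    obtain ⟨V, -, hV⟩ := this g.bound 0 rfl
    exact ⟨V, fun s => hV s s.zero_le⟩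
  intro n
  induction n with
  | zero =>
    refine fun m hm => ⟨∅, by simp, fun s hs => ?_⟩
    have := even_eq_zero (f := g) (t := s + 1) (by omega)
    simp [this]
  | succ n ih =>
    intro m hm
    obtain ⟨V, hV1, hV2⟩ := ih (m + 1) (by omega)
    have hmV : m ∉ V := fun h => absurd (hV1 m h) (by omega)
    by_cases hc : 0 < g.even (m + 1) ∧ m + 1 ∉ V
    · refine ⟨insert m V, fun s hs => ?_, fun s hs => ?_⟩
      · rcases Finset.mem_insert.1 hs with rfl | h
        exacts [le_rfl, (Nat.le_succ m).trans (hV1 s h)]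
      · rcases hs.eq_or_lt with rfl | hlt
        · simpa using hc
        · have h1 : s ≠ m := by omega
          have h2 : s + 1 ≠ m := by omega
          simpa [h1, h2] using hV2 s hlt
    · refine ⟨V, fun s hs => (Nat.le_succ m).trans (hV1 s hs), fun s hs => ?_⟩
      rcases hs.eq_or_lt with rfl | hlt
      · simp [hmV, hc]
      · exact hV2 s hlt

/-- Every frequency sequence `g` is the result of a step of any prescribed positive rank `p` smaller
than the rank of `g`: the set `U` of the step consists of the `p` largest elements of the solution
`V` of the recursion from above. -/
theorem exists_isStep_right {g : Freq} {p : ℕ} (hp : 0 < p) (hpg : p < g.rank) :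
    ∃ f t U, IsStep f g t U ∧ f.rank = p := by
  obtain ⟨V, hV⟩ := g.exists_greedyFromAbove
  have hones : ∀ y ∈ g.ones g.top, 0 < g.even y ∧ g.top < y ∧ y + 1 ∉ g.ones g.top := by
    intro y hy
    have hy' := mem_ones.1 hy
    obtain ⟨y, rfl⟩ : ∃ z, y = z + 1 := by
      refine ⟨y - 1, ?_⟩
      have : y ≠ 0 := by rintro rfl; simp [marks] at hy'
      omega
    have h1 := one_mem_marks_succ.1 hy'.2
    refine ⟨h1.1, hy'.1.lt_of_ne fun heq => ?_, fun hm => ?_⟩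
    · obtain ⟨x, hx, hxt⟩ := Finset.exists_mem_eq_sup g.odd
        (by rw [Finset.nonempty_iff_ne_empty]; intro h0; simp [top, h0] at heq) (· + 1)
      rw [← top, heq] at hxt
      obtain rfl : y = x := by simpa using hxt
      exact h1.2.1 hx
    · exact (one_mem_marks_succ.1 (mem_ones.1 hm).2).2.2 hy'.2
  -- the recursion from above selects at least as many elements as there are marks `1`
  have hcard : (g.ones g.top).card ≤ (V.filter (g.top ≤ ·)).card := by
    refine Finset.card_le_card_of_injOn (fun y => if y - 1 ∈ V then y - 1 else y)
      (fun y hy => ?_) fun y hy z hz hyz => ?_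
    · obtain ⟨h1, h2, h3⟩ := hones y hy
      have h4 := hV (y - 1)
      rw [Nat.sub_add_cancel (by omega)] at h4
      simp only [Finset.coe_filter, Set.mem_ofPred_eq]
      split_ifs with hm
      · exact ⟨hm, by omega⟩
      · exact ⟨by by_contra h; exact hm (h4.2 ⟨h1, h⟩), by omega⟩
    · obtain ⟨h1, h2, h3⟩ := hones y hy
      obtain ⟨k1, k2, k3⟩ := hones z hz
      have e1 : z ≠ y + 1 := by rintro rfl; exact h3 hz
      have e2 : y ≠ z + 1 := by rintro rfl; exact k3 hy
      simp only at hyz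
      split_ifs at hyz <;> omega
  -- the part of `V` from its `p`-th element from above on
  obtain ⟨t, htV, htop, htp⟩ : ∃ t ∈ V, g.top ≤ t ∧ (V.filter (t ≤ ·)).card = p := by
    have hex : ∃ n, (V.filter (n ≤ ·)).card < p := by
      refine ⟨V.sup (· + 1), ?_⟩
      rw [Finset.filter_false_of_mem]
      · simpa using hp
      · intro x hx h
        have : x + 1 ≤ V.sup (· + 1) := Finset.le_sup (f := (· + 1)) hx
        omega
    have hlt : g.top < Nat.find hex := by
      by_contra! hle
      have h1 := Nat.find_spec hex
      have h2 : V.filter (g.top ≤ ·) ⊆ V.filter (Nat.find hex ≤ ·) :=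
        Finset.monotone_filter_right _ fun x _ hx => hle.trans hx
      have h3 := Finset.card_le_card h2
      rw [rank] at hpg
      omega
    have h1 := Nat.find_spec hex
    have h2 := Nat.find_min hex (Nat.sub_lt (g.top.zero_le.trans_lt hlt) one_pos)
    set n := Nat.find hex
    have hn : n - 1 + 1 = n := by omega
    have h3 : ∀ x, x ∈ V.filter (n - 1 ≤ ·) ↔ (x = n - 1 ∧ x ∈ V) ∨ x ∈ V.filter (n ≤ ·) := by
      intro x
      simp only [Finset.mem_filter]
      constructor
      · rintro ⟨hx, hle⟩
        rcases hle.eq_or_lt with h | h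
        exacts [Or.inl ⟨h.symm, hx⟩, Or.inr ⟨hx, by omega⟩]
      · rintro (⟨rfl, hx⟩ | ⟨hx, hle⟩)
        exacts [⟨hx, le_rfl⟩, ⟨hx, by omega⟩]
    have hmem : n - 1 ∈ V := by
      by_contra hm
      have : V.filter (n - 1 ≤ ·) = V.filter (n ≤ ·) := by
        ext x; rw [h3]; constructor
        · rintro (⟨rfl, h⟩ | h)
          exacts [absurd h hm, h]
        · exact Or.inr
      rw [this] at h2
      exact h2 h1
    refine ⟨n - 1, hmem, by omega, ?_⟩
    have : V.filter (n - 1 ≤ ·) = insert (n - 1) (V.filter (n ≤ ·)) := by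
      ext x; rw [h3, Finset.mem_insert]; constructor
      · rintro (⟨rfl, h⟩ | h)
        exacts [Or.inl rfl, Or.inr h]
      · rintro (rfl | h)
        exacts [Or.inl ⟨rfl, hmem⟩, Or.inr h]
    have hni : n - 1 ∉ V.filter (n ≤ ·) := fun h => by
      have := (Finset.mem_filter.1 h).2
      omega
    rw [this, Finset.card_insert_of_notMem hni] at h2 ⊢
    omega
  set U := V.filter (t ≤ ·)
  have hU : ∀ s, s ∈ U ↔ s ∈ V ∧ t ≤ s := fun s => Finset.mem_filter
  let φ : ℕ → ℕ := fun s => if s ≤ t then g.even s else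
    g.even s + (if s ∈ U then 1 else 0) - if s - 1 ∈ U then 1 else 0
  have hφ : ∀ s, φ s ≠ 0 → s ∈ g.even.support ∪ U := fun s hs => by
    by_contra hn
    simp only [Finset.mem_union, Finsupp.mem_support_iff, not_or, not_not] at hn
    simp [φ, hn.1, hn.2] at hs
  have hgodd : ∀ s ∈ g.odd, s < t := fun s hs => (lt_top_of_mem hs).trans_le htop
  have hφs : ∀ s, t ≤ s → φ (s + 1) + (if s ∈ U then 1 else 0) =
      g.even (s + 1) + if s + 1 ∈ U then 1 else 0 := fun s hs => by
    have h1 : ¬ s + 1 ≤ t := by omega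
    simp only [φ, h1, if_false, Nat.add_sub_cancel]
    by_cases hm : s ∈ U
    · have := ((hV s).1 ((hU s).1 hm).1).1
      simp only [hm, if_true]; omega
    · simp [hm]
  let f : Freq := ⟨Finsupp.onFinset _ φ hφ, insert t g.odd, by simp [φ, g.even_zero]⟩
  have hstep : IsStep f g t U := by
    refine ⟨Finset.mem_insert_self _ _, fun s hs => ?_, ?_, (hU t).2 ⟨htV, le_rfl⟩,
      fun s hs => ((hU s).1 hs).2, fun s hs => ?_, fun s hs => ?_, fun s hs => ?_⟩
    · rcases Finset.mem_insert.1 hs with rfl | h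
      exacts [le_rfl, (hgodd s h).le]
    · exact (Finset.erase_insert fun h => (hgodd t h).false).symm
    · change g.even s = φ s
      exact (if_pos hs).symm
    · exact (hφs s hs).symm
    · have h1 := hφs s hs
      have h2 := hV s
      have h3 := hU s
      have h4 := hU (s + 1)
      have h5 := hV (s + 1)
      change _ ↔ 0 < φ (s + 1) ∧ _
      by_cases hm : s ∈ U <;> by_cases hm' : s + 1 ∈ U <;>
        simp only [hm, hm', if_true, if_false] at h1 h3 h4 ⊢ <;> grind
  exact ⟨f, t, U, hstep, hstep.card_eq_rank.symm.trans htp⟩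

/-! ### Removing all odd parts -/

theorem IsStep.right_unique {f g g' : Freq} {t t' : ℕ} {U U' : Finset ℕ} (h : IsStep f g t U)
    (h' : IsStep f g' t' U') : g = g' := by
  obtain rfl : t = t' :=
    le_antisymm (h'.le_of_mem_odd t h.mem_odd) (h.le_of_mem_odd t' h'.mem_odd)
  have hU : ∀ s, t ≤ s → (s ∈ U ↔ s ∈ U') := fun s hs => by
    rcases hs.eq_or_lt with rfl | hlt
    · simp [h.mem, h'.mem]
    · rw [h.mem_iff hlt, h'.mem_iff hlt]
  ext s
  · rcases Nat.lt_or_ge t s with hs | hs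
    · obtain ⟨s, rfl⟩ : ∃ s', s = s' + 1 := ⟨s - 1, by omega⟩
      have h1 := h.even_high s (by omega)
      have h2 := h'.even_high s (by omega)
      simp only [hU s (by omega), hU (s + 1) (by omega)] at h1
      omega
    · rw [h.even_low s hs, h'.even_low s hs]
  · rw [h.odd_eq, h'.odd_eq]

theorem IsStep.card_odd_lt {f g : Freq} {t : ℕ} {U : Finset ℕ} (h : IsStep f g t U) :
    g.odd.card < f.odd.card := by
  rw [h.odd_eq]; exact Finset.card_erase_lt_of_mem h.mem_odd

/-- Removes all odd parts, from the largest to the smallest, and records `1 - 2p` for each step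
of rank `p`. -/
noncomputable def split (f : Freq) : Finset ℤ × Freq :=
  if h : f.odd.Nonempty then
    (insert (1 - 2 * (f.rank : ℤ)) (split (exists_isStep h).choose).1,
      (split (exists_isStep h).choose).2)
  else (∅, f)
termination_by f.odd.card
decreasing_by all_goals exact (exists_isStep h).choose_spec.choose_spec.choose_spec.card_odd_lt

theorem split_of_odd_eq_empty {f : Freq} (h : f.odd = ∅) : f.split = (∅, f) := by
  rw [split, dif_neg (by simp [h])]

theorem IsStep.split_eq {f g : Freq} {t : ℕ} {U : Finset ℕ} (h : IsStep f g t U) :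
    f.split = (insert (1 - 2 * (f.rank : ℤ)) g.split.1, g.split.2) := by
  have hf : f.odd.Nonempty := ⟨t, h.mem_odd⟩
  rw [split, dif_pos hf,
    (exists_isStep hf).choose_spec.choose_spec.choose_spec.right_unique h]

/-- Induction along the steps. -/
theorem step_induction {P : Freq → Prop} (base : ∀ f, f.odd = ∅ → P f)
    (step : ∀ f g t U, IsStep f g t U → P g → P f) (f : Freq) : P f := by
  induction hn : f.odd.card using Nat.strong_induction_on generalizing f with
  | _ n ih =>
    subst hn
    rcases f.odd.eq_empty_or_nonempty with h | h
    · exact base f h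
    · obtain ⟨g, t, U, hg⟩ := exists_isStep h
      exact step f g t U hg (ih _ hg.card_odd_lt g rfl)

theorem odd_split (f : Freq) : f.split.2.odd = ∅ := by
  induction f using step_induction with
  | base f h => rw [split_of_odd_eq_empty h, h]
  | step f g t U h ih => rw [h.split_eq, ih]

theorem numMarked_split (f : Freq) (r : ℕ) : f.split.2.numMarked r = f.numMarked r := by
  induction f using step_induction with
  | base f h => rw [split_of_odd_eq_empty h]
  | step f g t U h ih => rw [h.split_eq, ih, h.numMarked_eq]

theorem initial_split (f : Freq) : f.split.2.initial = f.initial := by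
  induction f using step_induction with
  | base f h => rw [split_of_odd_eq_empty h]
  | step f g t U h ih => rw [h.split_eq, ih, h.initial_eq]

theorem le_of_mem_split {f : Freq} {x : ℤ} (hx : x ∈ f.split.1) : x ≤ 1 - 2 * (f.rank : ℤ) := by
  induction f using step_induction with
  | base f h => simp [split_of_odd_eq_empty h] at hx
  | step f g t U h ih =>
    rw [h.split_eq, Finset.mem_insert] at hx
    rcases hx with rfl | hx
    · exact le_rfl
    · have := ih hx
      have := h.rank_lt
      omega

theorem IsStep.notMem_split {f g : Freq} {t : ℕ} {U : Finset ℕ} (h : IsStep f g t U) :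
    1 - 2 * (f.rank : ℤ) ∉ g.split.1 := fun hm => by
  have := le_of_mem_split hm
  have := h.rank_lt
  omega

theorem split_mem_setD (f : Freq) : f.split.1 ∈ setD (f.numMarked 1) := by
  induction f using step_induction with
  | base f h => simp [split_of_odd_eq_empty h, setD]
  | step f g t U h ih =>
    rw [h.split_eq, h.numMarked_eq]
    intro x hx
    rcases Finset.mem_insert.1 hx with rfl | hx
    · have h1 := h.rank_le_numMarked
      rw [h.numMarked_eq] at h1
      have h2 : 0 < f.rank := Nat.succ_pos _
      exact ⟨⟨-f.rank, by ring⟩, by omega, by omega⟩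
    · exact ih x hx

theorem size_split (f : Freq) : (f.size : ℤ) = (∑ x ∈ f.split.1, x) + (f.split.2.size : ℤ) := by
  induction f using step_induction with
  | base f h => simp [split_of_odd_eq_empty h]
  | step f g t U h ih =>
    rw [h.split_eq, Finset.sum_insert h.notMem_split]
    have h1 := h.size_add_one
    rw [h.card_eq_rank] at h1
    simp only
    omega

theorem split_injective : Function.Injective split := by
  intro f
  induction f using step_induction with
  | base f h =>
    intro f' hf'
    rcases f'.odd.eq_empty_or_nonempty with h' | h'
    · rw [split_of_odd_eq_empty h, split_of_odd_eq_empty h'] at hf'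
      exact congrArg Prod.snd hf'
    · obtain ⟨g', t', U', hg'⟩ := exists_isStep h'
      rw [split_of_odd_eq_empty h, hg'.split_eq] at hf'
      exact absurd (congrArg Prod.fst hf').symm (Finset.insert_ne_empty _ _)
  | step f g t U h ih =>
    intro f' hf'
    rcases f'.odd.eq_empty_or_nonempty with h' | h'
    · rw [split_of_odd_eq_empty h', h.split_eq] at hf'
      exact absurd (congrArg Prod.fst hf') (Finset.insert_ne_empty _ _)
    · obtain ⟨g', t', U', hg'⟩ := exists_isStep h'
      have h1 : 1 - 2 * (f.rank : ℤ) ∈ f'.split.1 := by rw [← hf', h.split_eq]; simp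
      have h2 : 1 - 2 * (f'.rank : ℤ) ∈ f.split.1 := by rw [hf', hg'.split_eq]; simp
      have h3 := le_of_mem_split h1
      have h4 := le_of_mem_split h2
      have hr : f.rank = f'.rank := by omega
      rw [h.split_eq, hg'.split_eq, hr, Prod.mk.injEq] at hf'
      have h5 := congrArg (Finset.erase · (1 - 2 * (f'.rank : ℤ))) hf'.1
      rw [Finset.erase_insert hg'.notMem_split, Finset.erase_insert (hr ▸ h.notMem_split)] at h5
      obtain rfl : g = g' := ih (Prod.ext h5 hf'.2)
      exact h.left_unique hg' hr

/-- Surjectivity of the removal. The steps are undone in the order of decreasing rank, so that the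
greatest element of `η` is recorded by the step undone last. -/
theorem exists_split_eq {η : Finset ℤ} {g : Freq} (hg : g.odd = ∅)
    (hη : η ∈ setD (g.numMarked 1)) : ∃ f : Freq, f.split = (η, g) := by
  induction hn : η.card generalizing η with
  | zero => exact ⟨g, by rw [Finset.card_eq_zero.1 hn, split_of_odd_eq_empty hg]⟩
  | succ n ih =>
    have hne : η.Nonempty := Finset.card_pos.1 (by omega)
    have hx := η.max'_mem hne
    have hmax := fun y hy => η.le_max' y hy
    set x := η.max' hne
    obtain ⟨f', hf'⟩ := ih (η := η.erase x) (fun y hy => hη y (Finset.mem_of_mem_erase hy))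
      (by rw [Finset.card_erase_of_mem hx]; omega)
    obtain ⟨⟨m, hm⟩, h1, h2⟩ := hη x hx
    obtain ⟨p, hp⟩ : ∃ p : ℕ, x = 1 - 2 * (p : ℤ) := ⟨(-m).toNat, by omega⟩
    have hlt : p < f'.rank := by
      rcases f'.odd.eq_empty_or_nonempty with h' | h'
      · rw [split_of_odd_eq_empty h', Prod.mk.injEq] at hf'
        rw [rank_of_odd_eq_empty h', hf'.2]
        omega
      · obtain ⟨g', t', U', hg'⟩ := exists_isStep h'
        have h3 : 1 - 2 * (f'.rank : ℤ) ∈ f'.split.1 := by rw [hg'.split_eq]; simp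
        rw [hf', Finset.mem_erase] at h3
        have h4 := hmax _ h3.2
        have h5 := h3.1
        omega
    obtain ⟨f, t, U, hf, hr⟩ := exists_isStep_right (by omega) hlt
    exact ⟨f, by rw [hf.split_eq, hf', hr, ← hp, Finset.insert_erase hx]⟩

end Freq

/-! ### Frequency sequences of overpartitions -/

theorem not_odd_two_mul (t : ℕ) : ¬ Odd (2 * t) := by simp

namespace Freq

/-- The parts of size less than `2T`, in increasing order. -/
def partsBelow (f : Freq) : ℕ → List Part
  | 0 => []
  | T + 1 => f.partsBelow T ++ (List.replicate (f.even T) ⟨2 * T, false⟩ ++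
      if T ∈ f.odd then [⟨2 * T + 1, true⟩] else [])

theorem count_even_partsBelow (f : Freq) (t T : ℕ) :
    (f.partsBelow T).count ⟨2 * t, false⟩ = if t < T then f.even t else 0 := by
  induction T with
  | zero => simp [partsBelow]
  | succ T ih =>
    have h1 : (if T ∈ f.odd then [(⟨2 * T + 1, true⟩ : Part)] else []).count ⟨2 * t, false⟩ = 0 := by
      split_ifs <;> simp
    rw [partsBelow, List.count_append, List.count_append, ih, h1, List.count_replicate]
    rcases lt_trichotomy t T with h | rfl | h
    · simp [h, h.ne', h.trans (Nat.lt_succ_self T)]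
    · simp
    · simp [h.not_gt, h.ne, show ¬ t < T + 1 by omega]

theorem count_odd_partsBelow (f : Freq) (t T : ℕ) :
    (f.partsBelow T).count ⟨2 * t + 1, true⟩ = if t < T ∧ t ∈ f.odd then 1 else 0 := by
  induction T with
  | zero => simp [partsBelow]
  | succ T ih =>
    have h1 : (if T ∈ f.odd then [(⟨2 * T + 1, true⟩ : Part)] else []).count ⟨2 * t + 1, true⟩ =
        if t = T ∧ t ∈ f.odd then 1 else 0 := by
      by_cases h : t = T
      · subst h; split_ifs <;> simp_all
      · have h' : T ≠ t := Ne.symm h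
        split_ifs <;> simp_all
    rw [partsBelow, List.count_append, List.count_append, ih, h1, List.count_replicate]
    by_cases ho : t ∈ f.odd
    · rcases lt_trichotomy t T with h | rfl | h
      · simp [h, h.ne, ho, h.trans (Nat.lt_succ_self T)]
      · simp [ho]
      · simp [h.not_gt, h.ne', show ¬ t < T + 1 by omega]
    · simp [ho]

theorem mem_partsBelow {f : Freq} {T : ℕ} {a : Part} (h : a ∈ f.partsBelow T) :
    (a.overlined = true ↔ Odd a.size) ∧ 0 < a.size ∧ a.size < 2 * T := by
  induction T with
  | zero => simp [partsBelow] at h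
  | succ T ih =>
    rw [partsBelow, List.mem_append, List.mem_append, List.mem_replicate] at h
    rcases h with h | ⟨h0, rfl⟩ | h
    · have := ih h; exact ⟨this.1, this.2.1, by omega⟩
    · have hT : T ≠ 0 := by rintro rfl; exact h0 f.even_zero
      exact ⟨by simp, by simp only; omega, by simp only; omega⟩
    · split_ifs at h
      · rw [List.mem_singleton] at h
        subst h
        refine ⟨by simp, by simp, by simp; omega⟩
      · simp at h

theorem pairwise_partsBelow (f : Freq) (T : ℕ) :
    (f.partsBelow T).Pairwise fun a b => a.rank ≤ b.rank := by
  induction T with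
  | zero => simp [partsBelow]
  | succ T ih =>
    rw [partsBelow, List.pairwise_append, List.pairwise_append]
    refine ⟨ih, ⟨?_, ?_, ?_⟩, ?_⟩
    · simp [List.pairwise_replicate]
    · split_ifs <;> simp
    · intro a ha b hb
      rw [List.mem_replicate] at ha
      split_ifs at hb
      · rw [List.mem_singleton] at hb
        obtain ⟨-, rfl⟩ := ha
        subst hb
        simp [Part.rank]
      · simp at hb
    · intro a ha b hb
      have h1 := (mem_partsBelow ha).2.2
      have h2 : 2 * T ≤ b.size := by
        rw [List.mem_append, List.mem_replicate] at hb
        rcases hb with ⟨-, rfl⟩ | hb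
        · exact le_rfl
        · split_ifs at hb
          · rw [List.mem_singleton] at hb
            subst hb; simp
          · simp at hb
      unfold Part.rank
      split_ifs <;> omega

theorem sum_size_partsBelow (f : Freq) (T : ℕ) :
    ((f.partsBelow T).map Part.size).sum = f.sizeBelow T := by
  induction T with
  | zero => simp [partsBelow, sizeBelow]
  | succ T ih =>
    rw [partsBelow, List.map_append, List.sum_append, ih, sizeBelow, sizeBelow,
      Finset.sum_range_succ, List.map_append, List.sum_append, List.map_replicate, List.sum_replicate]
    split_ifs <;> simp [mul_comm]

/-- The overpartition with given frequencies. -/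
def toOverpartition (f : Freq) : Overpartition where
  parts := f.partsBelow f.bound
  sorted := f.pairwise_partsBelow _
  pos _ ha := (mem_partsBelow ha).2.1
  overlined_le_one t := by
    rcases Nat.even_or_odd' t with ⟨s, rfl | rfl⟩
    · rw [List.count_eq_zero_of_not_mem]
      · exact zero_le_one
      · intro h; exact not_odd_two_mul s ((mem_partsBelow h).1.1 rfl)
    · rw [count_odd_partsBelow]; split_ifs <;> simp

end Freq

namespace Overpartition

/-- The overlined parts are exactly the odd ones. -/
def OddOverlined (l : Overpartition) : Prop := ∀ a ∈ l.parts, (a.overlined = true ↔ Odd a.size)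

theorem le_size {l : Overpartition} {a : Part} (ha : a ∈ l.parts) : a.size ≤ l.size :=
  List.le_sum_of_mem (List.mem_map_of_mem ha)

/-- The frequencies of the non-overlined even and of the overlined odd parts. -/
noncomputable def freq (l : Overpartition) : Freq where
  even := Finsupp.onFinset (Finset.range (l.size + 1)) (fun t => l.parts.count ⟨2 * t, false⟩)
    fun t ht => by
      have h := le_size (List.count_pos_iff.1 (Nat.pos_of_ne_zero ht))
      simp only at h
      rw [Finset.mem_range]; omega
  odd := (Finset.range (l.size + 1)).filter fun t => (⟨2 * t + 1, true⟩ : Part) ∈ l.parts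
  even_zero := by
    rw [Finsupp.onFinset_apply, List.count_eq_zero]
    exact fun h => (l.pos _ h).false

theorem freq_even (l : Overpartition) (t : ℕ) : l.freq.even t = l.parts.count ⟨2 * t, false⟩ := rfl

theorem mem_freq_odd {l : Overpartition} {t : ℕ} :
    t ∈ l.freq.odd ↔ (⟨2 * t + 1, true⟩ : Part) ∈ l.parts := by
  rw [freq, Finset.mem_filter, Finset.mem_range, and_iff_right_iff_imp]
  intro h
  have h := le_size h
  simp only at h
  omega

theorem ext_parts {l l' : Overpartition} (h : l.parts = l'.parts) : l = l' := by
  cases l; cases l'; simp_all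

theorem parts_eq_partsBelow {l : Overpartition} (hl : l.OddOverlined) :
    l.parts = l.freq.partsBelow l.freq.bound := by
  refine List.Perm.eq_of_pairwise (le := fun a b => a.rank ≤ b.rank) ?_ l.sorted
    (Freq.pairwise_partsBelow _ _) ?_
  · rintro ⟨a, x⟩ ⟨b, y⟩ - - h1 h2
    have h3 := le_antisymm h1 h2
    unfold Part.rank at h3
    simp only at h3
    cases x <;> cases y <;> simp at h3 ⊢ <;> omega
  · rw [List.perm_iff_count]
    rintro ⟨s, x⟩
    by_cases hx : x = true ↔ Odd s
    · rcases Nat.even_or_odd' s with ⟨t, rfl | rfl⟩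
      · obtain rfl : x = false := by simpa [not_odd_two_mul] using hx
        rw [Freq.count_even_partsBelow, ← freq_even]
        split_ifs with h
        · rfl
        · exact Freq.even_eq_zero (not_lt.1 h)
      · obtain rfl : x = true := by simpa using hx
        rw [Freq.count_odd_partsBelow]
        by_cases hm : t ∈ l.freq.odd
        · rw [if_pos ⟨Freq.lt_bound_of_mem_odd hm, hm⟩]
          exact le_antisymm (l.overlined_le_one _) (List.count_pos_iff.2 (mem_freq_odd.1 hm))
        · rw [if_neg fun h => hm h.2, List.count_eq_zero]
          exact fun h => hm (mem_freq_odd.2 h)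
    · rw [List.count_eq_zero_of_not_mem fun h => hx (hl _ h),
        List.count_eq_zero_of_not_mem fun h => hx (Freq.mem_partsBelow h).1]

theorem toOverpartition_freq {l : Overpartition} (hl : l.OddOverlined) :
    l.freq.toOverpartition = l :=
  ext_parts (parts_eq_partsBelow hl).symm

theorem oddOverlined_toOverpartition (f : Freq) : f.toOverpartition.OddOverlined :=
  fun _ ha => (Freq.mem_partsBelow ha).1

theorem freq_toOverpartition (f : Freq) : f.toOverpartition.freq = f := by
  ext t
  · rw [freq_even, Freq.toOverpartition, Freq.count_even_partsBelow]
    split_ifs with h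
    · rfl
    · exact (Freq.even_eq_zero (not_lt.1 h)).symm
  · rw [mem_freq_odd, ← List.count_pos_iff, Freq.toOverpartition, Freq.count_odd_partsBelow]
    by_cases hm : t ∈ f.odd
    · simp [hm, Freq.lt_bound_of_mem_odd hm]
    · simp [hm]

theorem size_freq {l : Overpartition} (hl : l.OddOverlined) : l.freq.size = l.size := by
  rw [Freq.size, ← Freq.sum_size_partsBelow, ← parts_eq_partsBelow hl, size]

end Overpartition

/-! ### The Göllnitz–Gordon marking in terms of frequencies -/

theorem markAux_eq_foldl (all : List Part) (done : List (Part × ℕ)) (xs : List Part) :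
    markAux all done xs = (xs.foldl (fun d x => (x, nextMark all d x) :: d) done).reverse := by
  induction xs generalizing done with
  | nil => rfl
  | cons x xs ih => rw [markAux, ih, List.foldl_cons]

theorem mem_marksWhere {d : List (Part × ℕ)} {P : ℕ → Prop} [DecidablePred P] {m : ℕ} :
    m ∈ marksWhere d P ↔ ∃ x, (x, m) ∈ d ∧ P x.size := by
  simp [marksWhere]

section

variable {f : Freq} {all : List Part}

/-- Marking equal even parts one after the other. -/
theorem foldl_replicate_even (h1 : ∀ t, (⟨2 * t + 1, false⟩ : Part) ∉ all)
    (h2 : ∀ t, (⟨2 * t, true⟩ : Part) ∉ all) {T : ℕ} {S : Finset ℕ} {d : List (Part × ℕ)}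
    (hd : ∀ m, m ∈ marksWhere d (fun b => 2 * (T + 1) ≤ b + 2) ↔ m ∈ S) (n : ℕ) :
    ∃ E : List (Part × ℕ),
      (List.replicate n ⟨2 * (T + 1), false⟩).foldl (fun d x => (x, nextMark all d x) :: d) d =
        E ++ d ∧
      (∀ x m, (x, m) ∈ E ↔ x = ⟨2 * (T + 1), false⟩ ∧ m ∈ greedy S n) ∧
      ∀ r, (E.map Prod.snd).count r = if r ∈ greedy S n then 1 else 0 := by
  induction n with
  | zero => exact ⟨[], by simp, by simp [greedy], by simp [greedy]⟩
  | succ n ih =>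
    obtain ⟨E, hE, hmem, hcount⟩ := ih
    have hmark : nextMark all (E ++ d) ⟨2 * (T + 1), false⟩ = mex (S ∪ greedy S n) := by
      have ho : ¬ Odd (2 * (T + 1)) := by simp
      have h3 : ¬ ((⟨2 * (T + 1) - 1, false⟩ : Part) ∈ all ∨
          (⟨2 * (T + 1), true⟩ : Part) ∈ all) := by
        rw [not_or]
        exact ⟨h1 T, h2 (T + 1)⟩
      rw [nextMark, if_neg ho]
      simp only [Bool.false_eq_true, if_false, h3, false_and, and_false]
      refine leastUnused_eq_mex fun m => ?_
      rw [Finset.mem_union, ← hd m, mem_marksWhere, mem_marksWhere]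
      simp only [List.mem_append, hmem]
      constructor
      · rintro ⟨x, ⟨-, h⟩ | h, hx⟩
        exacts [Or.inr h, Or.inl ⟨x, h, hx⟩]
      · rintro (⟨x, h, hx⟩ | h)
        · exact ⟨x, Or.inr h, hx⟩
        · exact ⟨_, Or.inl ⟨rfl, h⟩, by simp⟩
    have hnot : mex (S ∪ greedy S n) ∉ greedy S n := fun h =>
      mex_notMem _ (Finset.mem_union_right S h)
    refine ⟨(⟨2 * (T + 1), false⟩, mex (S ∪ greedy S n)) :: E, ?_, fun x m => ?_, fun r => ?_⟩
    · rw [List.replicate_succ', List.foldl_append, hE, List.foldl_cons, List.foldl_nil, hmark]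
      rfl
    · rw [List.mem_cons, hmem, Prod.mk.injEq, greedy, Finset.mem_insert]
      tauto
    · rw [List.map_cons, List.count_cons, hcount, greedy]
      by_cases hr : r = mex (S ∪ greedy S n)
      · subst hr; simp [hnot]
      · simp [hr, Ne.symm hr]

/-- The marks that the Göllnitz–Gordon marking gives to the parts of size less than `2T`. -/
theorem foldl_partsBelow (h1 : ∀ t, (⟨2 * t + 1, false⟩ : Part) ∉ all)
    (h2 : ∀ t, (⟨2 * t, true⟩ : Part) ∉ all) (T : ℕ) :
    ∃ d : List (Part × ℕ),
      (f.partsBelow T).foldl (fun d x => (x, nextMark all d x) :: d) [] = d ∧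
      (∀ x m, (x, m) ∈ d ↔ ∃ t < T, (x = ⟨2 * t, false⟩ ∧ m ∈ f.marks t) ∨
        (x = ⟨2 * t + 1, true⟩ ∧ t ∈ f.odd ∧ m = mex (f.marks t))) ∧
      ∀ r, (d.map Prod.snd).count r = f.count r T := by
  induction T with
  | zero => exact ⟨[], by simp [Freq.partsBelow], by simp, by simp [Freq.count]⟩
  | succ T ih =>
    obtain ⟨d, hd, hmem, hcount⟩ := ih
    obtain ⟨E, hE, hEmem, hEcount⟩ : ∃ E : List (Part × ℕ),
        (List.replicate (f.even T) ⟨2 * T, false⟩).foldl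
          (fun d x => (x, nextMark all d x) :: d) d = E ++ d ∧
        (∀ x m, (x, m) ∈ E ↔ x = ⟨2 * T, false⟩ ∧ m ∈ f.marks T) ∧
        ∀ r, (E.map Prod.snd).count r = if r ∈ f.marks T then 1 else 0 := by
      cases T with
      | zero => exact ⟨[], by simp [f.even_zero], by simp [Freq.marks], by simp [Freq.marks]⟩
      | succ T =>
        refine foldl_replicate_even h1 h2 (fun m => ?_) _
        rw [mem_marksWhere]
        simp only [hmem]
        constructor
        · rintro ⟨x, ⟨t, ht, ⟨rfl, hm⟩ | ⟨rfl, hto, rfl⟩⟩, hx⟩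
          · simp only at hx
            obtain rfl : t = T := by omega
            split_ifs
            exacts [Finset.mem_insert_of_mem hm, hm]
          · simp only at hx
            obtain rfl : t = T := by omega
            rw [if_pos hto]
            exact Finset.mem_insert_self _ _
        · intro hm
          split_ifs at hm with hto
          · rcases Finset.mem_insert.1 hm with rfl | hm
            · exact ⟨_, ⟨T, Nat.lt_succ_self T, Or.inr ⟨rfl, hto, rfl⟩⟩, by simp; omega⟩
            · exact ⟨_, ⟨T, Nat.lt_succ_self T, Or.inl ⟨rfl, hm⟩⟩, by simp; omega⟩
          · exact ⟨_, ⟨T, Nat.lt_succ_self T, Or.inl ⟨rfl, hm⟩⟩, by simp; omega⟩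
    have hlt : ∀ t, t < T + 1 ↔ t < T ∨ t = T := fun t => by omega
    rw [Freq.partsBelow, List.foldl_append, hd, List.foldl_append, hE]
    by_cases hT : T ∈ f.odd
    · have hmark : nextMark all (E ++ d) ⟨2 * T + 1, true⟩ = mex (f.marks T) := by
        have ho : Odd (2 * T + 1) := by simp
        rw [nextMark, if_pos ho, if_pos rfl]
        refine leastUnused_eq_mex fun m => ?_
        rw [mem_marksWhere]
        simp only [List.mem_append, hEmem, hmem]
        constructor
        · rintro ⟨x, ⟨-, hm⟩ | ⟨t, ht, ⟨rfl, hm⟩ | ⟨rfl, hto, rfl⟩⟩, hx⟩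
          · exact hm
          · simp only at hx; omega
          · simp only at hx; omega
        · intro hm
          exact ⟨_, Or.inl ⟨rfl, hm⟩, rfl⟩
      refine ⟨_, rfl, fun x m => ?_, fun r => ?_⟩
      · rw [if_pos hT, List.foldl_cons, List.foldl_nil, hmark, List.mem_cons, List.mem_append,
          hEmem, hmem, Prod.mk.injEq]
        simp only [hlt, or_and_right, exists_or, exists_eq_left, hT, true_and]
        constructor <;> rintro (h | h | h)
        exacts [Or.inr (Or.inr h), Or.inr (Or.inl h), Or.inl h, Or.inr (Or.inr h),
          Or.inr (Or.inl h), Or.inl h]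
      · rw [if_pos hT, List.foldl_cons, List.foldl_nil, hmark, List.map_cons, List.count_cons,
          List.map_append, List.count_append, hEcount, hcount, Freq.count_succ]
        simp only [hT, true_and, beq_iff_eq]
        omega
    · refine ⟨_, rfl, fun x m => ?_, fun r => ?_⟩
      · rw [if_neg hT, List.foldl_nil, List.mem_append, hEmem, hmem]
        simp only [hlt, or_and_right, exists_or, exists_eq_left, hT, false_and, and_false, or_false]
        exact or_comm
      · rw [if_neg hT, List.foldl_nil, List.map_append, List.count_append, hEcount, hcount,
          Freq.count_succ]
        simp only [hT, false_and, if_false]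
        omega

end

namespace Overpartition

variable {l : Overpartition}

theorem OddOverlined.odd_notMem (hl : l.OddOverlined) (t : ℕ) :
    (⟨2 * t + 1, false⟩ : Part) ∉ l.parts := fun h => by simpa using hl _ h

theorem OddOverlined.even_notMem (hl : l.OddOverlined) (t : ℕ) :
    (⟨2 * t, true⟩ : Part) ∉ l.parts := fun h => not_odd_two_mul t ((hl _ h).1 rfl)

theorem numMarked_freq (hl : l.OddOverlined) (r : ℕ) : l.numMarked r = l.freq.numMarked r := by
  obtain ⟨d, hd, -, hcount⟩ := foldl_partsBelow (f := l.freq) hl.odd_notMem hl.even_notMem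
    l.freq.bound
  rw [← parts_eq_partsBelow hl] at hd
  rw [numMarked, marking, markAux_eq_foldl, hd, List.map_reverse, List.count_reverse, hcount,
    Freq.numMarked]

end Overpartition

/-! ### The sets `G` and `E` in terms of frequencies -/

namespace Freq

theorem card_blocked (f : Freq) (t : ℕ) :
    (f.blocked t).card = f.even t + if t ∈ f.odd then 1 else 0 := by
  rw [blocked]
  split_ifs
  · rw [Finset.card_insert_of_notMem (mex_notMem _), card_marks]
  · rw [card_marks, add_zero]

theorem numMarked_eq_zero {f : Freq} {r : ℕ} : f.numMarked r = 0 ↔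
    ∀ t, r ∉ f.marks t ∧ ¬ (t ∈ f.odd ∧ mex (f.marks t) = r) := by
  constructor
  · intro h t
    rw [← count_eq_numMarked r (le_max_right (t + 1) f.bound), count] at h
    have := Finset.sum_eq_zero_iff.1 h t (Finset.mem_range.2 (le_max_left (t + 1) f.bound))
    simpa using this
  · intro h
    rw [numMarked, count]
    refine Finset.sum_eq_zero fun t _ => ?_
    simp [(h t).1, (h t).2]

/-- The marks are less than `k` if and only if any three neighbouring frequencies have a sum
less than `k`: neighbouring parts have different marks, and a mark is at most the number of the
neighbouring parts not above the marked part. -/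
theorem numMarked_eq_zero_iff {f : Freq} {k : ℕ} (hk : 0 < k) :
    (∀ r, k ≤ r → f.numMarked r = 0) ↔
      ∀ t, f.even t + (if t ∈ f.odd then 1 else 0) + f.even (t + 1) ≤ k - 1 := by
  simp only [numMarked_eq_zero]
  constructor
  · intro h t
    have hlt : ∀ s, ∀ r ∈ f.marks s, r < k := fun s r hr => by
      by_contra! hkr
      exact (h r hkr s).1 hr
    have hdisj : Disjoint (f.blocked t) (f.marks (t + 1)) :=
      Finset.disjoint_right.2 (f.isFirst_marks t).disj
    rw [← card_blocked, ← card_marks f (t + 1), ← Finset.card_union_of_disjoint hdisj]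
    have hsub : f.blocked t ∪ f.marks (t + 1) ⊆ Finset.Ioo 0 k := fun r hr => by
      rw [Finset.mem_Ioo]
      rcases Finset.mem_union.1 hr with hr | hr
      · rw [blocked] at hr
        split_ifs at hr with ho
        · rcases Finset.mem_insert.1 hr with rfl | hr
          · refine ⟨mex_pos _, ?_⟩
            by_contra! hkr
            exact (h _ hkr t).2 ⟨ho, rfl⟩
          · exact ⟨marks_pos hr, hlt t r hr⟩
        · exact ⟨marks_pos hr, hlt t r hr⟩
      · exact ⟨marks_pos hr, hlt _ r hr⟩
    simpa using Finset.card_le_card hsub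
  · refine fun h r hr t => ⟨fun hm => ?_, fun hm => ?_⟩
    · cases t with
      | zero => simp [marks] at hm
      | succ t =>
        have h1 := le_of_mem_greedy hm
        have h2 := h t
        rw [← blocked, card_blocked] at h1
        omega
    · have h1 := mex_le (f.marks t)
      have h2 := h t
      rw [if_pos hm.1] at h2
      rw [card_marks, hm.2] at h1
      omega

/-- The conditions defining `G`, in terms of frequencies. -/
def IsGood (k i : ℕ) (N : Fin (k - 1) → ℕ) (f : Freq) : Prop :=
  f.initial ≤ i - 1 ∧ (∀ r, k ≤ r → f.numMarked r = 0) ∧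
    ∀ r : Fin (k - 1), f.numMarked ((r : ℕ) + 1) = N r

variable {k i : ℕ} {N : Fin (k - 1) → ℕ} {f g : Freq}

theorem isGood_congr (h1 : f.initial = g.initial) (h2 : ∀ r, f.numMarked r = g.numMarked r) :
    f.IsGood k i N ↔ g.IsGood k i N := by
  simp only [IsGood, h1, h2]

theorem IsGood.firstEntry_eq (h : f.IsGood k i N) : firstEntry k N = f.numMarked 1 := by
  rw [firstEntry]
  split_ifs with hk
  · exact (h.2.2 ⟨0, hk⟩).symm
  · exact (h.2.1 1 (by omega)).symm

end Freq

namespace Overpartition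

variable {l : Overpartition}

theorem fbar_odd (l : Overpartition) (t : ℕ) :
    l.fbar (2 * t + 1) = if t ∈ l.freq.odd then 1 else 0 := by
  rw [fbar]
  split_ifs with h
  · exact le_antisymm (l.overlined_le_one _) (List.count_pos_iff.2 (mem_freq_odd.1 h))
  · rw [List.count_eq_zero]
    exact fun hm => h (mem_freq_odd.2 hm)

theorem mem_setG {k i : ℕ} (hk : 0 < k) {N : Fin (k - 1) → ℕ} :
    l ∈ setG k i N ↔ l.OddOverlined ∧ l.freq.IsGood k i N := by
  have hodd : l.OddOverlined ↔ (∀ a ∈ l.parts, ¬ (Even a.size ∧ a.overlined = true)) ∧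
      ∀ a ∈ l.parts, ¬ (Odd a.size ∧ a.overlined = false) := by
    rw [← forall₂_and]
    refine forall₂_congr fun a _ => ?_
    rw [← Nat.not_odd_iff_even]
    cases a.overlined <;> simp
  rw [setG, Set.mem_ofPred_eq, ← hodd, and_comm, and_congr_right_iff]
  intro hl
  have hbar : ∀ t, l.fbar (2 * t) = 0 := fun t => List.count_eq_zero.2 (hl.even_notMem t)
  have hf : ∀ t, l.f (2 * t + 1) = 0 := fun t => List.count_eq_zero.2 (hl.odd_notMem t)
  have hhead : ∀ a ∈ l.parts.head?,
      (Odd a.size ∧ a.overlined = true) ∨ (Even a.size ∧ a.overlined = false) := fun a ha => by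
    have := hl a (List.mem_of_mem_head? ha)
    rw [← Nat.not_odd_iff_even, ← Bool.not_eq_true, this]
    tauto
  have h0 : l.fbar 1 + l.f 2 = l.freq.initial := by
    rw [Freq.initial, freq_even, ← fbar_odd]; rfl
  have hsum : ∀ t, l.fbar (2 * t) + l.f (2 * t) + l.fbar (2 * t + 1) + l.f (2 * t + 2) =
      l.freq.even t + (if t ∈ l.freq.odd then 1 else 0) + l.freq.even (t + 1) := fun t => by
    rw [hbar, fbar_odd, zero_add]; rfl
  have h3 : ∀ t, 1 ≤ l.f (2 * t + 1) → l.f (2 * t + 2) + 2 ≤ k := fun t ht => by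
    rw [hf] at ht; omega
  simp only [setF, Set.mem_ofPred_eq, IsF, IsO, h0, hsum, numMarked_freq hl, Freq.IsGood,
    Freq.numMarked_eq_zero_iff hk]
  exact ⟨fun h => ⟨h.1.1.1, h.1.1.2.1, h.2⟩, fun h => ⟨⟨⟨h.1, h.2.1, h3⟩, hhead⟩, h.2.2⟩⟩

theorem mem_setE {k i : ℕ} (hk : 0 < k) {N : Fin (k - 1) → ℕ} :
    l ∈ setE k i N ↔ l.OddOverlined ∧ l.freq.IsGood k i N ∧ l.freq.odd = ∅ := by
  rw [setE, Set.mem_ofPred_eq, mem_setG hk, and_assoc, and_congr_right_iff]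
  intro hl
  rw [and_congr_right_iff]
  intro _
  rw [Finset.eq_empty_iff_forall_notMem]
  constructor
  · intro h t ht
    exact h _ (mem_freq_odd.1 ht) ⟨by simp, rfl⟩
  · rintro h ⟨s, x⟩ ha ⟨⟨t, hs⟩, hx⟩
    simp only at hs hx
    subst hs hx
    exact h t (mem_freq_odd.2 ha)

theorem finite_size_eq (n : ℕ) : {l : Overpartition | l.size = n}.Finite := by
  let φ : Fin (n + 1) × Bool → Part := fun x => ⟨x.1, x.2⟩
  refine Set.Finite.of_finite_image (f := parts) (((List.finite_length_le (Fin (n + 1) × Bool)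
    n).image (List.map φ)).subset ?_) fun l _ l' _ h => ext_parts h
  rintro _ ⟨l, rfl, rfl⟩
  refine ⟨l.parts.map fun a => (Fin.ofNat (l.size + 1) a.size, a.overlined), ?_, ?_⟩
  · rw [Set.mem_ofPred_eq, List.length_map, ← List.length_map (f := Part.size)]
    refine List.length_le_sum_of_one_le _ fun s hs => ?_
    obtain ⟨a, ha, rfl⟩ := List.mem_map.1 hs
    exact l.pos a ha
  · rw [List.map_map]
    conv_rhs => rw [← List.map_id l.parts]
    refine List.map_congr_left fun a ha => ?_
    have := le_size ha
    simp only [φ, Function.comp, id, Fin.val_ofNat, Nat.mod_eq_of_lt (Nat.lt_succ_of_le this)]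

end Overpartition

/-! ### The bijection and the generating functions -/

open Overpartition in
/-- The bijection from `G` to `D × E` given by removing all odd parts. -/
theorem exists_equiv {k : ℕ} (hk : 0 < k) (i : ℕ) (N : Fin (k - 1) → ℕ) :
    ∃ Θ : setG k i N ≃ setD (firstEntry k N) × setE k i N, ∀ μ : setG k i N,
      (μ.1.size : ℤ) = (∑ x ∈ (Θ μ).1.1, x) + ((Θ μ).2.1.size : ℤ) := by
  have hG : ∀ μ : setG k i N, μ.1.OddOverlined ∧ μ.1.freq.IsGood k i N := fun μ =>
    (mem_setG hk).1 μ.2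
  have hE : ∀ μ : setG k i N, μ.1.freq.split.2.toOverpartition ∈ setE k i N := fun μ => by
    rw [mem_setE hk, freq_toOverpartition]
    exact ⟨oddOverlined_toOverpartition _, (Freq.isGood_congr (Freq.initial_split _)
      (Freq.numMarked_split _)).2 (hG μ).2, Freq.odd_split _⟩
  let φ : setG k i N → setD (firstEntry k N) × setE k i N := fun μ =>
    (⟨μ.1.freq.split.1, by rw [(hG μ).2.firstEntry_eq]; exact Freq.split_mem_setD _⟩,
      ⟨μ.1.freq.split.2.toOverpartition, hE μ⟩)
  have hinj : Function.Injective φ := fun μ μ' h => by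
    have h1 : μ.1.freq.split.1 = μ'.1.freq.split.1 := congrArg (fun x => x.1.1) h
    have h2 : μ.1.freq.split.2.toOverpartition = μ'.1.freq.split.2.toOverpartition :=
      congrArg (fun x => x.2.1) h
    have h3 := congrArg Overpartition.freq h2
    rw [freq_toOverpartition, freq_toOverpartition] at h3
    have h4 := Freq.split_injective (Prod.ext h1 h3)
    exact Subtype.ext ((toOverpartition_freq (hG μ).1).symm.trans
      ((congrArg Freq.toOverpartition h4).trans (toOverpartition_freq (hG μ').1)))
  have hsurj : Function.Surjective φ := fun ⟨η, ν⟩ => by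
    obtain ⟨h1, h2, h3⟩ := (mem_setE hk).1 ν.2
    obtain ⟨f, hf⟩ := Freq.exists_split_eq h3 (η := η.1) (by rw [← h2.firstEntry_eq]; exact η.2)
    have hf2 : f.split.2 = ν.1.freq := congrArg Prod.snd hf
    refine ⟨⟨f.toOverpartition, ?_⟩, Prod.ext (Subtype.ext ?_) (Subtype.ext ?_)⟩
    · rw [mem_setG hk, freq_toOverpartition]
      refine ⟨oddOverlined_toOverpartition _, (Freq.isGood_congr ?_ fun r => ?_).2 h2⟩
      · rw [← hf2, Freq.initial_split]
      · rw [← hf2, Freq.numMarked_split]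
    · simp only [φ, freq_toOverpartition, hf]
    · simp only [φ, freq_toOverpartition, hf, toOverpartition_freq h1]
  refine ⟨Equiv.ofBijective φ ⟨hinj, hsurj⟩, fun μ => ?_⟩
  change (μ.1.size : ℤ) = (∑ x ∈ μ.1.freq.split.1, x) +
    (μ.1.freq.split.2.toOverpartition.size : ℤ)
  rw [← size_freq (hG μ).1, Freq.size_split,
    ← size_freq (oddOverlined_toOverpartition μ.1.freq.split.2), freq_toOverpartition]

theorem qpow_mul_qpow (m n : ℤ) : qpow m * qpow n = qpow (m + n) := by
  rw [qpow, qpow, HahnSeries.single_mul_single, one_mul, qpow]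

theorem prod_qpow (s : Finset ℤ) : ∏ x ∈ s, qpow x = qpow (∑ x ∈ s, x) := by
  induction s using Finset.induction_on with
  | empty => rfl
  | insert a s ha ih => rw [Finset.prod_insert ha, Finset.sum_insert ha, ih, qpow_mul_qpow]

/-- The odd integers in `[1 - 2M, -1]`. -/
def negOdds (M : ℕ) : Finset ℤ := (Finset.range M).image fun j : ℕ => 1 - 2 * (M : ℤ) + 2 * (j : ℤ)

theorem setD_eq (M : ℕ) : setD M = ↑(negOdds M).powerset := by
  ext η
  simp only [setD, Set.mem_ofPred_eq, Finset.mem_coe, Finset.mem_powerset, Finset.subset_iff]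
  refine forall₂_congr fun x _ => ?_
  rw [negOdds, Finset.mem_image]
  constructor
  · rintro ⟨⟨m, rfl⟩, h1, h2⟩
    exact ⟨(m + M).toNat, Finset.mem_range.2 (by omega), by omega⟩
  · rintro ⟨j, hj, rfl⟩
    have := Finset.mem_range.1 hj
    exact ⟨⟨j - M, by ring⟩, by omega, by omega⟩

theorem qPochhammer_eq (M : ℕ) : qPochhammer (-qpow (1 - 2 * (M : ℤ))) (qpow 2) M =
    ∑ η ∈ (negOdds M).powerset, qpow (∑ x ∈ η, x) := by
  have hpow : ∀ j : ℕ, qpow 2 ^ j = qpow (2 * j) := fun j => by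
    rw [qpow, HahnSeries.single_pow, one_pow, qpow, nsmul_eq_mul, mul_comm]
  rw [← Finset.sum_congr rfl fun η _ => prod_qpow η, ← Finset.prod_one_add, negOdds,
    Finset.prod_image (fun a _ b _ h => by simpa using h), qPochhammer]
  refine Finset.prod_congr rfl fun j _ => ?_
  rw [hpow, neg_mul, sub_neg_eq_add, qpow_mul_qpow]

theorem coeff_genFun (S : Set Overpartition) (n : ℤ) :
    (genFun S).coeff n = (Nat.card {l : S // (l.1.size : ℤ) = n} : ℤ) := by
  rw [genFun, PowerSeries.coeff_coe]
  split_ifs with hn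
  · have : IsEmpty {l : S // (l.1.size : ℤ) = n} := ⟨fun l => by have := l.2; omega⟩
    simp
  · rw [PowerSeries.coeff_mk, ← Nat.card_coe_set_eq, Nat.cast_inj]
    refine Nat.card_congr
      { toFun := fun l => ⟨⟨l.1, l.2.1⟩, by have := l.2.2; simp only; omega⟩
        invFun := fun l => ⟨l.1.1, l.1.2, by have := l.2; omega⟩
        left_inv := fun _ => rfl
        right_inv := fun _ => rfl }

theorem genFun_eq_of_equiv {G E : Set Overpartition} {M : ℕ} (Θ : G ≃ setD M × E)
    (hΘ : ∀ μ : G, (μ.1.size : ℤ) = (∑ x ∈ (Θ μ).1.1, x) + ((Θ μ).2.1.size : ℤ)) :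
    genFun G = qPochhammer (-qpow (1 - 2 * (M : ℤ))) (qpow 2) M * genFun E := by
  ext n
  rw [qPochhammer_eq, Finset.sum_mul, HahnSeries.coeff_sum, coeff_genFun]
  have hterm : ∀ m : ℤ, (qpow m * genFun E).coeff n =
      (Nat.card {l : E // (l.1.size : ℤ) = n - m} : ℤ) := fun m => by
    rw [qpow, HahnSeries.coeff_single_mul, one_mul, coeff_genFun]
  rw [Finset.sum_congr rfl fun η _ => hterm _, ← Nat.cast_sum, Nat.cast_inj,
    ← Finset.sum_coe_sort]
  have hfin : ∀ m : ℤ, Finite {l : E // (l.1.size : ℤ) = m} := fun m =>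
    have := (Overpartition.finite_size_eq m.toNat).to_subtype
    Finite.of_injective (β := {l : Overpartition | l.size = m.toNat}) (fun l => ⟨l.1.1, by
      have h : (l.1.1.size : ℤ) = m := l.2
      rw [Set.mem_ofPred_eq]; omega⟩) fun l l' h => by
        have h' : l.1.1 = l'.1.1 := by simpa using h
        exact Subtype.ext (Subtype.ext h')
  rw [← Nat.card_sigma]
  have hD : ∀ η : (negOdds M).powerset, η.1 ∈ setD M := fun η => by rw [setD_eq]; exact η.2
  have hD' : ∀ η : setD M, η.1 ∈ (negOdds M).powerset := fun η => by
    rw [← Finset.mem_coe, ← setD_eq]; exact η.2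
  refine Nat.card_congr
    { toFun := fun μ => ⟨⟨(Θ μ.1).1.1, hD' _⟩, ⟨(Θ μ.1).2, by
        have := hΘ μ.1; have := μ.2; simp only; omega⟩⟩
      invFun := fun x => ⟨Θ.symm (⟨x.1.1, hD x.1⟩, x.2.1), by
        have := hΘ (Θ.symm (⟨x.1.1, hD x.1⟩, x.2.1))
        rw [Equiv.apply_symm_apply] at this
        have := x.2.2
        simp only at *
        omega⟩
      left_inv := fun μ => Subtype.ext (Θ.symm_apply_apply μ.1)
      right_inv := fun x => Sigma.subtype_ext (by simp) (by simp) }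

end GollnitzGordon

theorem mainTheorem6 (k i : ℕ) (hi : 1 ≤ i) (hik : i ≤ k)
    (N : Fin (k - 1) → ℕ) (hN : Antitone N) :
    (∃ Θ : GollnitzGordon.setG k i N ≃
        GollnitzGordon.setD (GollnitzGordon.firstEntry k N) × GollnitzGordon.setE k i N,
      ∀ μ : GollnitzGordon.setG k i N,
        (μ.1.size : ℤ) = (∑ x ∈ (Θ μ).1.1, x) + ((Θ μ).2.1.size : ℤ)) ∧
    (∀ n : ℕ, {μ ∈ GollnitzGordon.setG k i N | μ.size = n}.Finite) ∧
    (∀ n : ℕ, {ν ∈ GollnitzGordon.setE k i N | ν.size = n}.Finite) ∧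
    GollnitzGordon.genFun (GollnitzGordon.setG k i N) =
      GollnitzGordon.qPochhammer
          (-GollnitzGordon.qpow (1 - 2 * (GollnitzGordon.firstEntry k N : ℤ)))
          (GollnitzGordon.qpow 2) (GollnitzGordon.firstEntry k N) *
        GollnitzGordon.genFun (GollnitzGordon.setE k i N) := by
  obtain ⟨Θ, hΘ⟩ := GollnitzGordon.exists_equiv (hi.trans hik) i N
  exact ⟨⟨Θ, hΘ⟩,
    fun n => (GollnitzGordon.Overpartition.finite_size_eq n).subset fun _ h => h.2,
    fun n => (GollnitzGordon.Overpartition.finite_size_eq n).subset fun _ h => h.2,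
    GollnitzGordon.genFun_eq_of_equiv Θ hΘ⟩
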